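/- Let $\Phi:\mathbb R\to\mathbb R$ be an $N$-function, i.e. $\Phi(x)=\int_0^{|x|}\varphi(t)\,dt$ with $\varphi:[0,\infty)\to\mathbb R$ non-decreasing, right-continuous, $\varphi(0)=0$, $\varphi(t)>0$ for $t>0$ and $\varphi(t)\to\infty$ as $t\to\infty$. Assume that $\Phi$ is continuously differentiable and strictly convex, and that it satisfies - $\Delta_2(0)$: there are $x_0>0$, $K>2$ with $\Phi(2x)\le K\Phi(x)$ for $0\le x\le x_0$; - $\nabla_2(0)$: there are $x_0>0$, $c>1$ with $\Phi(x)\le\frac1{2c}\Phi(cx)$ for $0\le x\le x_0$. Let $G$ be a discrete group with a finite symmetric generating set $S=S^{-1}$, acting freely on a countable set $X$. Put $(\lambda(g)f)(x)=f(g^{-1}x)$ for $f:X\to\mathbb R$. Let $\rho_\Phi(f)=\sum_{x\in X}\Phi(f(x))$ and let $\ell^\Phi(X)=\{f:X\to\mathbb R\mid \rho_\Phi(af)<\infty\text{ for some }a>0\}$ with the norm $\|f\|=\inf\{k>0\mid\rho_\Phi(f/k)\le1\}$, regarded as a $G$-module via $\lambda$. Let $Z^1(G,\ell^\Phi(X))$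 be the space of maps $b:G\to\ell^\Phi(X)$ with $b(gh)=b(g)+\lambda(g)b(h)$, with the topology of uniform convergence on compact (that is, finite) subsets of $G$; let $B^1(G,\ell^\Phi(X))$ be the subspace of the maps $g\mapsto\lambda(g)v-v$, $v\in\ell^\Phi(X)$, let $\overline{B}^1$ be its closure in $Z^1$, and put $\overline H^1(G,\ell^\Phi(X))=Z^1(G,\ell^\Phi(X))/\overline{B}^1(G,\ell^\Phi(X))$. Let $D^\Phi(X)=\{f:X\to\mathbb R\mid\lambda(g)f-f\in\ell^\Phi(X)\text{ for all }g\in G\}$, let $D^\Phi(X)^G$ be the subspace of the functions in $D^\Phi(X)$ that are constant on the $G$-orbits, and let $HD^\Phi(X)$ be the set of $h\in D^\Phi(X)$ such that $$\sum_{s\in S}\Phi'\bigl(h(s^{-1}x)-h(x)\bigr)=0\quad\text{for all }x\in X.$$ Write $HD^\Phi(X)/D^\Phi(X)^G$ for the quotient of the set $HD^\Phi(X)$ by the relation $h\sim h'\iff h-h'\in D^\Phi(X)^G$. Then assigning to $h$ the class of the cocycle $g\mapsto\lambda(g)h-h$ gives a well-defined bijection $$HD^\Phi(X)/D^\Phi(X)^G\longrightarrow\overline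 H^1(G,\ell^\Phi(X)).$$ -/

import Mathlib

/-! ### N-functions -/

/-- `Φ` is an N-function: `Φ x = ∫₀^{|x|} φ(t) dt`, where `φ` is defined on `[0, ∞)`, non-decreasing,
right-continuous, positive on `(0, ∞)`, zero at zero and tends to infinity. (The values of `φ` at
negative arguments are irrelevant.) -/
def IsNFunction (Φ : ℝ → ℝ) : Prop :=
  ∃ φ : ℝ → ℝ, MonotoneOn φ (Set.Ici 0) ∧
    (∀ t, 0 ≤ t → ContinuousWithinAt φ (Set.Ici t) t) ∧
    (∀ t, 0 < t → 0 < φ t) ∧ φ 0 = 0 ∧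
    Filter.Tendsto φ Filter.atTop Filter.atTop ∧
    ∀ x, Φ x = ∫ t in (0 : ℝ)..|x|, φ t

/-- The type of N-functions. -/
structure NFunction where
  /-- the underlying function -/
  toFun : ℝ → ℝ
  isNFunction : IsNFunction toFun

namespace NFunction

instance : CoeFun NFunction (fun _ => ℝ → ℝ) := ⟨NFunction.toFun⟩

/-- The condition `Δ₂(0)`. -/
def DeltaTwo (Φ : NFunction) : Prop :=
  ∃ x₀ K : ℝ, 0 < x₀ ∧ 2 < K ∧ ∀ x, 0 ≤ x → x ≤ x₀ → Φ (2 * x) ≤ K * Φ x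

/-- The condition `∇₂(0)`. -/
def NablaTwo (Φ : NFunction) : Prop :=
  ∃ x₀ c : ℝ, 0 < x₀ ∧ 1 < c ∧ ∀ x, 0 ≤ x → x ≤ x₀ → Φ x ≤ 1 / (2 * c) * Φ (c * x)

lemma zero (Φ : NFunction) : Φ 0 = 0 := by
  obtain ⟨φ, -, -, -, -, -, h⟩ := Φ.isNFunction
  simp [h]

lemma neg (Φ : NFunction) (x : ℝ) : Φ (-x) = Φ x := by
  obtain ⟨φ, -, -, -, -, -, h⟩ := Φ.isNFunction
  simp [h]

lemma abs (Φ : NFunction) (x : ℝ) : Φ |x| = Φ x := by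
  obtain ⟨φ, -, -, -, -, -, h⟩ := Φ.isNFunction
  simp [h]

/-- Subgradient inequality on the half-line. -/
lemma exists_subgradient (Φ : NFunction) :
    ∃ φ : ℝ → ℝ, (∀ t, 0 ≤ t → 0 ≤ φ t) ∧ (∀ t, 0 < t → 0 < φ t) ∧
      ∀ x y, 0 ≤ x → 0 ≤ y → Φ x + φ x * (y - x) ≤ Φ y := by
  obtain ⟨φ, hm, -, hp, h0, -, h⟩ := Φ.isNFunction
  have hint : ∀ a b, 0 ≤ a → 0 ≤ b → IntervalIntegrable φ MeasureTheory.volume a b := by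
    intro a b ha hb
    apply MonotoneOn.intervalIntegrable
    apply hm.mono
    intro t ht
    exact le_trans (le_min ha hb) ht.1
  refine ⟨φ, ?_, hp, ?_⟩
  · intro t ht
    rcases ht.eq_or_lt with rfl | ht
    · exact h0.ge
    · exact (hp t ht).le
  · intro x y hx hy
    have e : Φ y - Φ x = ∫ t in x..y, φ t := by
      rw [h, h, abs_of_nonneg hx, abs_of_nonneg hy]
      exact intervalIntegral.integral_interval_sub_left (hint 0 y le_rfl hy) (hint 0 x le_rfl hx)
    rcases le_total x y with hxy | hxy
    · have : ∫ _t in x..y, φ x ≤ ∫ t in x..y, φ t := by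
        apply intervalIntegral.integral_mono_on hxy (by simp) (hint x y hx hy)
        intro t ht
        exact hm hx (le_trans hx ht.1) ht.1
      simp at this
      linarith
    · have : ∫ t in y..x, φ t ≤ ∫ _t in y..x, φ x := by
        apply intervalIntegral.integral_mono_on hxy (hint y x hy hx) (by simp)
        intro t ht
        exact hm (le_trans hy ht.1) hx ht.2
      rw [intervalIntegral.integral_symm] at e
      simp at this
      linarith

lemma nonneg (Φ : NFunction) (x : ℝ) : 0 ≤ Φ x := by
  obtain ⟨φ, h0, -, hs⟩ := Φ.exists_subgradient
  have h1 := hs 0 |x| le_rfl (abs_nonneg x)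
  rw [Φ.abs, Φ.zero] at h1
  have := mul_nonneg (h0 0 le_rfl) (abs_nonneg x)
  simp at h1
  linarith

lemma pos (Φ : NFunction) {x : ℝ} (hx : x ≠ 0) : 0 < Φ x := by
  obtain ⟨φ, -, hp, hs⟩ := Φ.exists_subgradient
  have hx' := abs_pos.2 hx
  have h1 := hs (|x| / 2) |x| (by positivity) (abs_nonneg x)
  rw [Φ.abs] at h1
  have h2 := Φ.nonneg (|x| / 2)
  have h3 := mul_pos (hp (|x| / 2) (by positivity)) (show 0 < |x| - |x| / 2 by linarith)
  linarith

/-- Convexity of N-functions. -/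
lemma convex (Φ : NFunction) {a b : ℝ} (ha : 0 ≤ a) (hb : 0 ≤ b) (hab : a + b = 1) (x y : ℝ) :
    Φ (a * x + b * y) ≤ a * Φ x + b * Φ y := by
  obtain ⟨φ, h0, -, hs⟩ := Φ.exists_subgradient
  have hm0 : 0 ≤ |a * x + b * y| := abs_nonneg _
  have hm : |a * x + b * y| ≤ a * |x| + b * |y| := by
    refine (abs_add_le _ _).trans ?_
    rw [abs_mul, abs_mul, abs_of_nonneg ha, abs_of_nonneg hb]
  have h1 := mul_le_mul_of_nonneg_left (hs _ |x| hm0 (abs_nonneg _)) ha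
  have h2 := mul_le_mul_of_nonneg_left (hs _ |y| hm0 (abs_nonneg _)) hb
  have h3 := mul_le_mul_of_nonneg_left hm (h0 _ hm0)
  simp only [Φ.abs] at h1 h2
  have hb' : b = 1 - a := by linarith
  subst hb'
  nlinarith

lemma convex_zero (Φ : NFunction) {t : ℝ} (h0 : 0 ≤ t) (h1 : t ≤ 1) (x : ℝ) :
    Φ (t * x) ≤ t * Φ x := by
  have := Φ.convex h0 (sub_nonneg.2 h1) (by ring) x 0
  simpa [Φ.zero] using this

end NFunction

/-! ### Orlicz spaces on a discrete set -/

section Orlicz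

variable {X : Type*}

/-- The modular `ρ_Φ(f) = ∑_{x} Φ(f x)`, with values in `[0, ∞]`. -/
noncomputable def orliczModular (Φ : NFunction) (f : X → ℝ) : ENNReal :=
  ∑' x, ENNReal.ofReal (Φ (f x))

lemma orliczModular_zero (Φ : NFunction) : orliczModular Φ (0 : X → ℝ) = 0 := by
  simp [orliczModular, Φ.zero]

lemma orliczModular_convex (Φ : NFunction) {a b : ℝ} (ha : 0 ≤ a) (hb : 0 ≤ b) (hab : a + b = 1)
    (f g : X → ℝ) :
    orliczModular Φ (a • f + b • g) ≤
      ENNReal.ofReal a * orliczModular Φ f + ENNReal.ofReal b * orliczModular Φ g := by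
  unfold orliczModular
  rw [← ENNReal.tsum_mul_left, ← ENNReal.tsum_mul_left, ← ENNReal.tsum_add]
  refine ENNReal.tsum_le_tsum fun x => ?_
  rw [← ENNReal.ofReal_mul ha, ← ENNReal.ofReal_mul hb,
    ← ENNReal.ofReal_add (mul_nonneg ha (Φ.nonneg _)) (mul_nonneg hb (Φ.nonneg _))]
  exact ENNReal.ofReal_le_ofReal (Φ.convex ha hb hab _ _)

lemma orliczModular_smul_le (Φ : NFunction) {t : ℝ} (h0 : 0 ≤ t) (h1 : t ≤ 1) (f : X → ℝ) :
    orliczModular Φ (t • f) ≤ ENNReal.ofReal t * orliczModular Φ f := by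
  have := orliczModular_convex Φ h0 (sub_nonneg.2 h1) (by ring) f 0
  simpa [orliczModular_zero] using this

lemma orliczModular_mono (Φ : NFunction) {s t : ℝ} (hs : 0 ≤ s) (hst : s ≤ t) (f : X → ℝ) :
    orliczModular Φ (s • f) ≤ orliczModular Φ (t • f) := by
  rcases (hs.trans hst).eq_or_lt with h | h
  · have : s = t := by linarith
    rw [this]
  · have h1 : s / t ≤ 1 := (div_le_one h).2 hst
    have := orliczModular_smul_le Φ (div_nonneg hs h.le) h1 (t • f)
    rw [smul_smul, div_mul_cancel₀ _ h.ne'] at this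
    refine this.trans (mul_le_of_le_one_left' ?_)
    exact ENNReal.ofReal_le_one.2 h1

lemma orliczModular_neg (Φ : NFunction) (f : X → ℝ) :
    orliczModular Φ (-f) = orliczModular Φ f := by
  simp [orliczModular, Φ.neg]

/-- `{f : X → ℝ | ρ_Φ(a f) < ∞ for some a > 0}`, as a linear subspace of all functions. -/
def orliczSubmodule (Φ : NFunction) (X : Type*) : Submodule ℝ (X → ℝ) where
  carrier := {f | ∃ a : ℝ, 0 < a ∧ orliczModular Φ (a • f) < ⊤}
  zero_mem' := ⟨1, one_pos, by simp [orliczModular_zero]⟩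
  add_mem' := by
    rintro f g ⟨a, ha, hf⟩ ⟨b, hb, hg⟩
    refine ⟨min a b / 2, by positivity, ?_⟩
    have h := orliczModular_convex Φ (a := 1 / 2) (b := 1 / 2) (by norm_num) (by norm_num)
      (by norm_num) (min a b • f) (min a b • g)
    have e : (min a b / 2) • (f + g)
        = (1 / 2 : ℝ) • (min a b • f) + (1 / 2 : ℝ) • (min a b • g) := by
      rw [smul_smul, smul_smul, smul_add]
      congr 2 <;> ring
    rw [e]
    refine h.trans_lt (ENNReal.add_lt_top.2 ⟨?_, ?_⟩)
    · exact ENNReal.mul_lt_top ENNReal.ofReal_lt_top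
        ((orliczModular_mono Φ (by positivity) (min_le_left a b) f).trans_lt hf)
    · exact ENNReal.mul_lt_top ENNReal.ofReal_lt_top
        ((orliczModular_mono Φ (by positivity) (min_le_right a b) g).trans_lt hg)
  smul_mem' := by
    rintro c f ⟨a, ha, hf⟩
    refine ⟨a / (|c| + 1), by positivity, ?_⟩
    have hc : 0 < |c| + 1 := by positivity
    have key : orliczModular Φ ((a / (|c| + 1) * |c|) • f) < ⊤ := by
      refine (orliczModular_mono Φ (by positivity) ?_ f).trans_lt hf
      rw [div_mul_eq_mul_div, div_le_iff₀ hc]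
      nlinarith [abs_nonneg c]
    rw [smul_smul]
    rcases abs_choice c with h | h
    · rwa [h] at key ⊢
    · rw [← orliczModular_neg, ← neg_smul]
      rw [h] at key ⊢
      simpa using key

/-- The Orlicz space `ℓ^Φ(X)`. It is a type of its own, so that its topology is the one of the gauge
norm and not that of pointwise convergence. -/
def OrliczSpace (Φ : NFunction) (X : Type*) : Type _ := ↥(orliczSubmodule Φ X)

namespace OrliczSpace

noncomputable instance (Φ : NFunction) : AddCommGroup (OrliczSpace Φ X) :=
  inferInstanceAs (AddCommGroup ↥(orliczSubmodule Φ X))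

noncomputable instance (Φ : NFunction) : Module ℝ (OrliczSpace Φ X) :=
  inferInstanceAs (Module ℝ ↥(orliczSubmodule Φ X))

/-- The inclusion of `ℓ^Φ(X)` into the space of all functions. -/
def val (Φ : NFunction) : OrliczSpace Φ X →ₗ[ℝ] (X → ℝ) := (orliczSubmodule Φ X).subtype

/-- The gauge (Luxemburg) norm `inf {k > 0 | ρ_Φ(f / k) ≤ 1}`. -/
noncomputable def gaugeNorm (Φ : NFunction) (f : X → ℝ) : ℝ :=
  sInf {k : ℝ | 0 < k ∧ orliczModular Φ (k⁻¹ • f) ≤ 1}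

lemma gaugeSet_bddBelow (Φ : NFunction) (f : X → ℝ) :
    BddBelow {k : ℝ | 0 < k ∧ orliczModular Φ (k⁻¹ • f) ≤ 1} := ⟨0, fun _ hk => hk.1.le⟩

lemma gaugeSet_nonempty (Φ : NFunction) {f : X → ℝ} (hf : f ∈ orliczSubmodule Φ X) :
    {k : ℝ | 0 < k ∧ orliczModular Φ (k⁻¹ • f) ≤ 1}.Nonempty := by
  obtain ⟨a, ha, hf⟩ := hf
  set R := (orliczModular Φ (a • f)).toReal with hR
  have hR0 : 0 ≤ R := ENNReal.toReal_nonneg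
  have ht : 0 < (R + 1)⁻¹ := by positivity
  refine ⟨((R + 1)⁻¹ * a)⁻¹, by positivity, ?_⟩
  rw [inv_inv, ← smul_smul]
  refine (orliczModular_smul_le Φ ht.le (inv_le_one_of_one_le₀ (by linarith)) _).trans ?_
  rw [← ENNReal.ofReal_toReal hf.ne, ← hR, ← ENNReal.ofReal_mul ht.le]
  refine ENNReal.ofReal_le_one.2 ?_
  rw [inv_mul_le_iff₀ (by positivity)]
  linarith

lemma gaugeNorm_nonneg (Φ : NFunction) (f : X → ℝ) : 0 ≤ gaugeNorm Φ f :=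
  Real.sInf_nonneg fun _ hk => hk.1.le

lemma gaugeNorm_zero (Φ : NFunction) : gaugeNorm Φ (0 : X → ℝ) = 0 := by
  refine le_antisymm (le_of_forall_pos_le_add fun ε hε => ?_) (gaugeNorm_nonneg Φ _)
  rw [zero_add]
  exact csInf_le (gaugeSet_bddBelow Φ _) ⟨hε, by simp [orliczModular_zero]⟩

lemma gaugeNorm_neg (Φ : NFunction) (f : X → ℝ) : gaugeNorm Φ (-f) = gaugeNorm Φ f := by
  simp only [gaugeNorm, smul_neg, orliczModular_neg]

lemma gaugeNorm_add_le (Φ : NFunction) {f g : X → ℝ} (hf : f ∈ orliczSubmodule Φ X)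
    (hg : g ∈ orliczSubmodule Φ X) :
    gaugeNorm Φ (f + g) ≤ gaugeNorm Φ f + gaugeNorm Φ g := by
  refine le_of_forall_pos_le_add fun ε hε => ?_
  obtain ⟨k, ⟨hk, hk'⟩, hkε⟩ := Real.lt_sInf_add_pos (gaugeSet_nonempty Φ hf) (half_pos hε)
  obtain ⟨l, ⟨hl, hl'⟩, hlε⟩ := Real.lt_sInf_add_pos (gaugeSet_nonempty Φ hg) (half_pos hε)
  have hkl : 0 < k + l := by positivity
  have h : gaugeNorm Φ (f + g) ≤ k + l := by
    refine csInf_le (gaugeSet_bddBelow Φ _) ⟨hkl, ?_⟩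
    have e : (k + l)⁻¹ • (f + g) = (k / (k + l)) • (k⁻¹ • f) + (l / (k + l)) • (l⁻¹ • g) := by
      rw [smul_smul, smul_smul, smul_add]
      congr 2 <;> field_simp
    have hs : k / (k + l) + l / (k + l) = 1 := by field_simp
    rw [e]
    refine (orliczModular_convex Φ (by positivity) (by positivity) hs _ _).trans ?_
    refine (add_le_add (mul_le_mul_right hk' _) (mul_le_mul_right hl' _)).trans ?_
    rw [mul_one, mul_one, ← ENNReal.ofReal_add (by positivity) (by positivity), hs]
    simp
  have h1 : k < gaugeNorm Φ f + ε / 2 := hkε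
  have h2 : l < gaugeNorm Φ g + ε / 2 := hlε
  linarith

lemma gaugeNorm_smul_le (Φ : NFunction) (c : ℝ) {f : X → ℝ} (hf : f ∈ orliczSubmodule Φ X) :
    gaugeNorm Φ (c • f) ≤ |c| * gaugeNorm Φ f := by
  rcases eq_or_ne c 0 with rfl | hc
  · simp [gaugeNorm_zero]
  have hc' : 0 < |c| := abs_pos.2 hc
  rw [← div_le_iff₀' hc']
  refine le_csInf (gaugeSet_nonempty Φ hf) ?_
  rintro k ⟨hk, hk'⟩
  rw [div_le_iff₀' hc']
  refine csInf_le (gaugeSet_bddBelow Φ _) ⟨by positivity, ?_⟩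
  rw [smul_smul]
  rcases abs_choice c with h | h
  · have : (|c| * k)⁻¹ * c = k⁻¹ := by rw [h]; field_simp
    rwa [this]
  · have : (|c| * k)⁻¹ * c = -k⁻¹ := by rw [h]; field_simp
    rwa [this, neg_smul, orliczModular_neg]

lemma eq_zero_of_gaugeNorm_eq_zero (Φ : NFunction) {f : X → ℝ} (hf : f ∈ orliczSubmodule Φ X)
    (h : gaugeNorm Φ f = 0) : f = 0 := by
  funext x
  by_contra hx
  have hpos := Φ.pos hx
  obtain ⟨k, ⟨hk, hk'⟩, hkε⟩ := Real.lt_sInf_add_pos (gaugeSet_nonempty Φ hf)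
    (lt_min one_pos hpos)
  have hk2 : k < gaugeNorm Φ f + min 1 (Φ (f x)) := hkε
  rw [h, zero_add, lt_min_iff] at hk2
  have h1 : Φ (k⁻¹ * f x) ≤ 1 := by
    have := (ENNReal.le_tsum (f := fun y => ENNReal.ofReal (Φ ((k⁻¹ • f) y))) x).trans hk'
    exact ENNReal.ofReal_le_one.1 this
  have h2 := Φ.convex_zero hk.le hk2.1.le (k⁻¹ * f x)
  rw [mul_inv_cancel_left₀ hk.ne'] at h2
  nlinarith [hk2.2]

/-- `ℓ^Φ(X)` with the gauge norm. -/
noncomputable instance (Φ : NFunction) : NormedAddCommGroup (OrliczSpace Φ X) :=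
  AddGroupNorm.toNormedAddCommGroup
    { toFun := fun f => gaugeNorm Φ (val Φ f)
      map_zero' := by rw [map_zero, gaugeNorm_zero]
      add_le' := fun f g => by rw [map_add]; exact gaugeNorm_add_le Φ f.2 g.2
      neg' := fun f => by rw [map_neg, gaugeNorm_neg]
      eq_zero_of_map_eq_zero' := fun f h =>
        Subtype.ext (eq_zero_of_gaugeNorm_eq_zero Φ f.2 h) }

lemma norm_def (Φ : NFunction) (f : OrliczSpace Φ X) : ‖f‖ = gaugeNorm Φ (val Φ f) := rfl

noncomputable instance (Φ : NFunction) : NormedSpace ℝ (OrliczSpace Φ X) where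
  norm_smul_le c f := by
    rw [norm_def, norm_def, map_smul]
    exact gaugeNorm_smul_le Φ c f.2

end OrliczSpace

end Orlicz

/-! ### First cohomology and reduced first cohomology -/

section Cohomology

variable {G V : Type*} [Group G] [TopologicalSpace G] [AddCommGroup V] [Module ℝ V]
  [TopologicalSpace V] [IsTopologicalAddGroup V] [ContinuousSMul ℝ V]

/-- `Z¹(G, V)`: continuous maps `b` with `b (g h) = b g + π(g) (b h)`. It carries the topology
induced by `C(G, V)`, that is, of uniform convergence on compact subsets of `G`. -/
def cocyclesOne (π : Representation ℝ G V) : Submodule ℝ C(G, V) where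
  carrier := {b | ∀ g h, b (g * h) = b g + π g (b h)}
  zero_mem' := by intro g h; simp
  add_mem' := by
    intro b c hb hc g h
    simp only [ContinuousMap.add_apply, hb g h, hc g h, map_add]
    abel
  smul_mem' := by
    intro r b hb g h
    simp only [ContinuousMap.smul_apply, hb g h, map_smul, smul_add]

/-- `B¹(G, V)`, as a subspace of `Z¹(G, V)`. -/
def coboundariesOne (π : Representation ℝ G V) : Submodule ℝ (cocyclesOne π) where
  carrier := {b | ∃ v : V, ∀ g, b.1 g = π g v - v}
  zero_mem' := ⟨0, fun g => by simp⟩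
  add_mem' := by
    rintro b c ⟨v, hv⟩ ⟨w, hw⟩
    refine ⟨v + w, fun g => ?_⟩
    simp only [Submodule.coe_add, ContinuousMap.add_apply, hv g, hw g, map_add]
    abel
  smul_mem' := by
    rintro r b ⟨v, hv⟩
    refine ⟨r • v, fun g => ?_⟩
    simp only [Submodule.coe_smul, ContinuousMap.smul_apply, hv g, map_smul, smul_sub]

/-- The reduced cohomology: `Z¹(G, V)` modulo the closure of `B¹(G, V)` in `Z¹(G, V)`. -/
abbrev ReducedCohomologyOne (π : Representation ℝ G V) : Type _ :=
  cocyclesOne π ⧸ (coboundariesOne π).topologicalClosure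

end Cohomology

/-! ### Dirichlet finite and harmonic functions -/

section Dirichlet

variable (G : Type*) {X : Type*} [Group G] [MulAction G X]

/-- The permutation representation `(λ(g) f)(x) = f(g⁻¹ x)` on all real functions on `X`. -/
def permutationRep (X : Type*) [MulAction G X] : Representation ℝ G (X → ℝ) where
  toFun g :=
    { toFun := fun f x => f (g⁻¹ • x)
      map_add' := fun _ _ => rfl
      map_smul' := fun _ _ => rfl }
  map_one' := by ext; simp
  map_mul' g h := by
    refine LinearMap.ext fun f => funext fun x => ?_
    simp [mul_smul]

lemma orliczModular_permutationRep (Φ : NFunction) (g : G) (f : X → ℝ) :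
    orliczModular Φ (permutationRep G X g f) = orliczModular Φ f :=
  (MulAction.toPerm g⁻¹ : Equiv.Perm X).tsum_eq fun x => ENNReal.ofReal (Φ (f x))

lemma permutationRep_mem_orlicz (Φ : NFunction) (g : G) {f : X → ℝ}
    (hf : f ∈ orliczSubmodule Φ X) : permutationRep G X g f ∈ orliczSubmodule Φ X := by
  obtain ⟨a, ha, hf⟩ := hf
  refine ⟨a, ha, ?_⟩
  rwa [← map_smul, orliczModular_permutationRep]

/-- The `G`-module `ℓ^Φ(X)`: the restriction of the permutation representation. -/
def orliczRep (Φ : NFunction) (X : Type*) [MulAction G X] :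
    Representation ℝ G (OrliczSpace Φ X) where
  toFun g := (permutationRep G X g).restrict fun _ hf => permutationRep_mem_orlicz G Φ g hf
  map_one' := by
    refine LinearMap.ext fun f => Subtype.ext ?_
    change permutationRep G X 1 f.1 = f.1
    rw [map_one]; rfl
  map_mul' g h := by
    refine LinearMap.ext fun f => Subtype.ext ?_
    change permutationRep G X (g * h) f.1 = permutationRep G X g (permutationRep G X h f.1)
    rw [map_mul]; rfl

/-- The space `D^Φ(X)` of `Φ`-Dirichlet finite functions: all `λ(g) f - f` lie in `ℓ^Φ(X)`. -/
def dirichletSpace (Φ : NFunction) (X : Type*) [MulAction G X] : Submodule ℝ (X → ℝ) where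
  carrier := {f | ∀ g : G, permutationRep G X g f - f ∈ orliczSubmodule Φ X}
  zero_mem' g := by simp
  add_mem' := by
    intro f h hf hh g
    have := add_mem (hf g) (hh g)
    rw [map_add]
    convert this using 1
    abel
  smul_mem' := by
    intro c f hf g
    rw [map_smul, ← smul_sub]
    exact Submodule.smul_mem _ c (hf g)

/-- `D^Φ(X)^G`: the functions in `D^Φ(X)` that are constant on the `G`-orbits. -/
def dirichletInvariants (Φ : NFunction) (X : Type*) [MulAction G X] :
    Submodule ℝ (dirichletSpace G Φ X) where
  carrier := {f | ∀ (g : G) (x : X), f.1 (g • x) = f.1 x}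
  zero_mem' _ _ := rfl
  add_mem' := by
    intro f h hf hh g x
    simp [hf g x, hh g x]
  smul_mem' := by
    intro c f hf g x
    simp [hf g x]

variable {G}

/-- The `Φ`-Laplacian `(Δ_Φ f)(x) = ∑_{s ∈ S} Φ'(f(s⁻¹ x) - f(x))`. -/
noncomputable def orliczLaplacian (Φ : NFunction) (S : Finset G) (f : X → ℝ) (x : X) : ℝ :=
  ∑ s ∈ S, deriv Φ (f (s⁻¹ • x) - f x)

/-- The set `HD^Φ(X)` of `Φ`-harmonic functions in `D^Φ(X)`. It need not be a linear subspace. -/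
def harmonicFunctions (Φ : NFunction) (S : Finset G) (X : Type*) [MulAction G X] :
    Set (dirichletSpace G Φ X) :=
  {f | ∀ x, orliczLaplacian Φ S f.1 x = 0}

/-- Harmonic functions are identified if they differ by an element of `D^Φ(X)^G`. -/
def harmonicSetoid (Φ : NFunction) (S : Finset G) (X : Type*) [MulAction G X] :
    Setoid (harmonicFunctions Φ S X) :=
  (QuotientAddGroup.leftRel (dirichletInvariants G Φ X).toAddSubgroup).comap Subtype.val

lemma harmonicSetoid_iff (Φ : NFunction) (S : Finset G) (h₁ h₂ : harmonicFunctions Φ S X) :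
    harmonicSetoid Φ S X h₁ h₂ ↔ h₂.1 - h₁.1 ∈ dirichletInvariants G Φ X := by
  rw [harmonicSetoid, Setoid.comap_rel, QuotientAddGroup.leftRel_apply, neg_add_eq_sub]
  rfl

/-- The quotient `HD^Φ(X) / D^Φ(X)^G`. -/
abbrev HarmonicQuotient (Φ : NFunction) (S : Finset G) (X : Type*) [MulAction G X] : Type _ :=
  Quotient (harmonicSetoid Φ S X)

/-- The linear map `α : D^Φ(X) → Z¹(G, ℓ^Φ(X))`, `α(f)(g) = λ(g) f - f`, for discrete `G`. -/
noncomputable def dirichletCocycle [TopologicalSpace G] [DiscreteTopology G] (Φ : NFunction) :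
    dirichletSpace G Φ X →ₗ[ℝ] cocyclesOne (orliczRep G Φ X) where
  toFun f :=
    ⟨⟨fun g => (⟨permutationRep G X g f.1 - f.1, f.2 g⟩ : orliczSubmodule Φ X),
      continuous_of_discreteTopology⟩, by
      intro g h
      refine Subtype.ext ?_
      change permutationRep G X (g * h) f.1 - f.1 = (permutationRep G X g f.1 - f.1) +
        permutationRep G X g (permutationRep G X h f.1 - f.1)
      rw [map_mul, map_sub, Module.End.mul_apply]
      abel⟩
  map_add' f h := by
    refine Subtype.ext (ContinuousMap.ext fun g => Subtype.ext ?_)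
    change permutationRep G X g (f.1 + h.1) - (f.1 + h.1) =
      (permutationRep G X g f.1 - f.1) + (permutationRep G X g h.1 - h.1)
    rw [map_add]
    abel
  map_smul' c f := by
    refine Subtype.ext (ContinuousMap.ext fun g => Subtype.ext ?_)
    change permutationRep G X g (c • f.1) - c • f.1 = c • (permutationRep G X g f.1 - f.1)
    rw [map_smul, smul_sub]

end Dirichlet

/-!
The inverse of the map is obtained by minimizing the `Φ`-energy `∑_{s, x} Φ(f(s⁻¹ x) - f(x))` in each
reduced cohomology class. As the action is free, every cocycle is `g ↦ λ(g) f - f` for some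
`f ∈ D^Φ(X)` (`dirichletCocycle_surjective`), and as `S` generates `G`, everything can be read off
the gradient `∇f` of `f` on the edge set `S × X` (`edgeGradient`). Write `φ = Φ'`. Green's formula
`∑ φ(∇h) ∇v = -2 ∑ v Δ_Φ h` (`NFunction.DeltaTwo.tsum_deriv_gradient_mul`) says that `h ∈ D^Φ(X)` is
harmonic if and only if `∇h` is a critical point of the modular in the directions `∇v`,
`v ∈ ℓ^Φ(X)`.

*Uniqueness.* By the Young inequality `|φ(a) u| ≤ (Φ(2a) + Φ(2tu)) / 2t` and `Δ₂(0)`, the functional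
`∑ φ(∇h) u` is continuous on `ℓ^Φ`, so for harmonic `h` it vanishes on the closure of `B¹`
(`tsum_deriv_mul_eq_zero_of_mem_closure`). If `h` and `k` are harmonic and cohomologous, then
`∑ (φ(∇h) - φ(∇k)) (∇h - ∇k) = 0`. All terms are nonnegative, and strict convexity gives `∇h = ∇k`.

*Existence.* Neither reflexivity nor duality of Orlicz spaces is used. For finite `A ⊆ X`, let
`h_A` minimize the energy among the functions that differ from `f` only on `A`. Along an ultrafilter
on the finite sets the gradients `∇h_A` converge pointwise, to a gradient `∇h`. The pairing
`∑ φ(a) u` is continuous in either argument for pointwise convergence on modular-bounded sets: in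
`a` because of `Δ₂(0)`, in `u` because of `∇₂(0)` (`NFunction.DeltaTwo.tendsto_tsum_deriv_mul_left`,
`NFunction.DeltaTwo.tendsto_tsum_deriv_mul`). Hence `h` is harmonic, and the subgradient inequalities
between `∇h_A` and `∇h` squeeze the energies of `h_A` to that of `h`. Pointwise convergence together
with convergence of the modulars is convergence in norm
(`NFunction.DeltaTwo.tendsto_tsum_mul_sub`), so that the coboundaries of `h_A - f` tend to the
cocycle of `h - f`. The abstract form of this is `NFunction.DeltaTwo.exists_tendsto_critical`.
-/

open Filter Topology

/-! ### Scalar inequalities for N-functions -/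

namespace NFunction

variable (Φ : NFunction)

lemma convexOn_univ : ConvexOn ℝ Set.univ Φ :=
  ⟨convex_univ, fun x _ y _ _ _ ha hb hab => Φ.convex ha hb hab x y⟩

lemma le_of_abs_le {x y : ℝ} (h : |x| ≤ |y|) : Φ x ≤ Φ y := by
  rcases (abs_nonneg y).eq_or_lt with hy | hy
  · have hx : x = 0 := abs_nonpos_iff.1 (h.trans hy.ge)
    rw [hx, Φ.zero]
    exact Φ.nonneg y
  · have h1 : |x| / |y| ≤ 1 := (div_le_one hy).2 h
    have h2 := Φ.convex_zero (by positivity) h1 |y|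
    rw [div_mul_cancel₀ _ hy.ne', Φ.abs, Φ.abs] at h2
    exact h2.trans (mul_le_of_le_one_left (Φ.nonneg y) h1)

/-- Sublevel sets of an N-function are bounded. -/
lemma exists_abs_le (R : ℝ) : ∃ M : ℝ, 0 < M ∧ ∀ x, Φ x ≤ R → |x| ≤ M := by
  have h1 : 0 < Φ 1 := Φ.pos one_ne_zero
  refine ⟨max 1 (R / Φ 1), by positivity, fun x hx => ?_⟩
  by_contra! hlt
  obtain ⟨hx1, hx2⟩ := max_lt_iff.1 hlt
  have hx0 : 0 < |x| := one_pos.trans hx1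
  have h2 := Φ.convex_zero (inv_nonneg.2 hx0.le) (inv_le_one_of_one_le₀ hx1.le) |x|
  rw [inv_mul_cancel₀ hx0.ne', Φ.abs, inv_mul_eq_div, le_div_iff₀ hx0] at h2
  rw [div_lt_iff₀ h1] at hx2
  linarith

lemma convex_half (x y : ℝ) : Φ (x + y) ≤ 1 / 2 * (Φ (2 * x) + Φ (2 * y)) := by
  have := Φ.convex (a := 1 / 2) (b := 1 / 2) (by norm_num) (by norm_num) (by norm_num)
    (2 * x) (2 * y)
  convert this using 1
  · congr 1
    ring
  · ring

variable {Φ}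

/-- Under `Δ₂(0)`, dilations are controlled uniformly on every sublevel set of `Φ`. -/
lemma DeltaTwo.exists_mul_le (hΦ : Φ.DeltaTwo) (R c : ℝ) :
    ∃ C : ℝ, 0 < C ∧ ∀ x, Φ x ≤ R → Φ (c * x) ≤ C * Φ x := by
  obtain ⟨x₀, K, hx₀, hK, h⟩ := hΦ
  have two (R : ℝ) : ∃ C : ℝ, 0 < C ∧ ∀ x, Φ x ≤ R → Φ (2 * x) ≤ C * Φ x := by
    obtain ⟨M, hM, hb⟩ := Φ.exists_abs_le R
    have h0 : 0 < Φ x₀ := Φ.pos hx₀.ne'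
    refine ⟨max K (Φ (2 * M) / Φ x₀), lt_max_of_lt_left (by linarith), fun x hx => ?_⟩
    rcases le_total |x| x₀ with hle | hle
    · have h1 := h |x| (abs_nonneg x) hle
      rw [Φ.abs, ← Φ.abs (2 * |x|), abs_mul, abs_abs, ← abs_mul, Φ.abs] at h1
      exact h1.trans (mul_le_mul_of_nonneg_right (le_max_left _ _) (Φ.nonneg x))
    · have h1 : Φ (2 * x) ≤ Φ (2 * M) := by
        apply Φ.le_of_abs_le
        rw [abs_mul, abs_mul, abs_of_pos hM]
        have := hb x hx
        gcongr
      have h2 : Φ x₀ ≤ Φ x := Φ.le_of_abs_le (by rwa [abs_of_pos hx₀])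
      calc Φ (2 * x) ≤ Φ (2 * M) / Φ x₀ * Φ x₀ := by rwa [div_mul_cancel₀ _ h0.ne']
        _ ≤ max K (Φ (2 * M) / Φ x₀) * Φ x := by
          gcongr
          exact le_max_right _ _
  have pow (j : ℕ) : ∃ C : ℝ, 0 < C ∧ ∀ x, Φ x ≤ R → Φ (2 ^ j * x) ≤ C * Φ x := by
    induction j with
    | zero => exact ⟨1, one_pos, fun x _ => by simp⟩
    | succ j ih =>
      obtain ⟨C, hC, hj⟩ := ih
      obtain ⟨D, hD, h2⟩ := two (C * R)
      refine ⟨D * C, by positivity, fun x hx => ?_⟩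
      have h3 := hj x hx
      have h4 := h2 (2 ^ j * x) (h3.trans (by gcongr))
      rw [pow_succ', mul_assoc, mul_assoc]
      exact h4.trans (by gcongr)
  obtain ⟨j, hj⟩ := pow_unbounded_of_one_lt |c| one_lt_two
  obtain ⟨C, hC, h1⟩ := pow j
  refine ⟨C, hC, fun x hx => (Φ.le_of_abs_le ?_).trans (h1 x hx)⟩
  rw [abs_mul, abs_mul]
  exact mul_le_mul_of_nonneg_right (hj.le.trans (le_abs_self _)) (abs_nonneg _)

/-- Under `∇₂(0)`, `Φ (t x)` is small compared to `t Φ(x)` as `t → 0`, uniformly on every sublevel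
set of `Φ`. -/
lemma NablaTwo.exists_mul_le (hΦ : Φ.NablaTwo) (R : ℝ) {ε : ℝ} (hε : 0 < ε) :
    ∃ t : ℝ, 0 < t ∧ ∀ x, Φ x ≤ R → Φ (t * x) ≤ ε * t * Φ x := by
  obtain ⟨x₀, c, hx₀, hc, h⟩ := hΦ
  have hc0 : 0 < c := one_pos.trans hc
  have hci : c⁻¹ ≤ 1 := inv_le_one_of_one_le₀ hc.le
  obtain ⟨M, hM, hb⟩ := Φ.exists_abs_le R
  obtain ⟨k, hk⟩ := pow_unbounded_of_one_lt (M / x₀) hc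
  obtain ⟨j, hj⟩ := exists_pow_lt_of_lt_one hε (show (1 / 2 : ℝ) < 1 by norm_num)
  have key : ∀ j x, Φ x ≤ R → Φ (c⁻¹ ^ (k + j) * x) ≤ (1 / 2) ^ j * c⁻¹ ^ (k + j) * Φ x := by
    intro j x hx
    induction j with
    | zero => simpa using Φ.convex_zero (by positivity) (pow_le_one₀ (by positivity) hci) x
    | succ j ih =>
      have h1 : c⁻¹ ^ (k + (j + 1)) * |x| ≤ x₀ := by
        have h2 : c⁻¹ ^ (k + (j + 1)) ≤ c⁻¹ ^ k :=
          pow_le_pow_of_le_one (by positivity) hci (by omega)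
        calc c⁻¹ ^ (k + (j + 1)) * |x| ≤ c⁻¹ ^ k * M := by
              have := hb x hx
              gcongr
          _ ≤ x₀ := by
              rw [inv_pow, inv_mul_le_iff₀ (by positivity)]
              rw [div_lt_iff₀ hx₀] at hk
              exact hk.le
      have h2 := h (c⁻¹ ^ (k + (j + 1)) * |x|) (by positivity) h1
      have h3 : c * (c⁻¹ ^ (k + (j + 1)) * |x|) = |c⁻¹ ^ (k + j) * x| := by
        rw [abs_mul, abs_of_pos (show 0 < c⁻¹ ^ (k + j) by positivity), ← add_assoc, pow_succ]
        field_simp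
      have h4 : c⁻¹ ^ (k + (j + 1)) * |x| = |c⁻¹ ^ (k + (j + 1)) * x| := by
        rw [abs_mul, abs_of_pos (show 0 < c⁻¹ ^ (k + (j + 1)) by positivity)]
      rw [h3, h4, Φ.abs, Φ.abs] at h2
      refine h2.trans ((mul_le_mul_of_nonneg_left ih (by positivity)).trans_eq ?_)
      rw [← add_assoc, pow_succ, pow_succ]
      field_simp
  refine ⟨c⁻¹ ^ (k + j), by positivity, fun x hx => (key j x hx).trans ?_⟩
  have := Φ.nonneg x
  gcongr

lemma continuous_deriv (hC : ContDiff ℝ 1 Φ) : Continuous (deriv Φ) := hC.continuous_deriv le_rfl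

lemma deriv_tangent_le (hC : ContDiff ℝ 1 Φ) (x y : ℝ) : Φ x + deriv Φ x * (y - x) ≤ Φ y := by
  have hd : DifferentiableAt ℝ Φ x := (hC.differentiable one_ne_zero) x
  rcases lt_trichotomy x y with h | rfl | h
  · have := Φ.convexOn_univ.deriv_le_slope (Set.mem_univ x) (Set.mem_univ y) h hd
    rw [slope_def_field, le_div_iff₀ (by linarith)] at this
    linarith
  · simp
  · have := Φ.convexOn_univ.slope_le_deriv (Set.mem_univ y) (Set.mem_univ x) h hd
    rw [slope_def_field, div_le_iff₀ (by linarith)] at this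
    linarith

lemma deriv_neg_arg (x : ℝ) : deriv Φ (-x) = -deriv Φ x := by
  have h : (fun y => Φ (-y)) = Φ := funext Φ.neg
  have := deriv_comp_neg (f := (Φ : ℝ → ℝ)) x
  rw [h] at this
  linarith

/-- A Young inequality for the pair `(Φ', Φ)` with a free dilation `t`; it replaces the
complementary N-function. -/
lemma abs_deriv_mul_le (hC : ContDiff ℝ 1 Φ) (a u : ℝ) {t : ℝ} (ht : 0 < t) :
    |deriv Φ a * u| ≤ (Φ (2 * a) + Φ (2 * (t * u))) / (2 * t) := by
  rw [le_div_iff₀ (by positivity)]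
  have h1 := deriv_tangent_le hC a (a + t * u)
  have h2 := deriv_tangent_le hC a (a + -(t * u))
  have h3 := Φ.convex_half a (t * u)
  have h4 := Φ.convex_half a (-(t * u))
  have h5 : Φ (2 * -(t * u)) = Φ (2 * (t * u)) := by rw [mul_neg, Φ.neg]
  have h6 := Φ.nonneg a
  rw [h5] at h4
  rcases abs_cases (deriv Φ a * u) with ⟨h, -⟩ | ⟨h, -⟩ <;> rw [h] <;> nlinarith

lemma eq_of_deriv_sub_mul_nonpos (hC : ContDiff ℝ 1 Φ)
    (hconv : StrictConvexOn ℝ Set.univ Φ) {x y : ℝ}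
    (h : (deriv Φ x - deriv Φ y) * (x - y) ≤ 0) : x = y := by
  have hm := hconv.strictMonoOn_deriv fun z _ => (hC.differentiable one_ne_zero) z
  rcases lt_trichotomy x y with hlt | heq | hlt
  · nlinarith [hm (Set.mem_univ x) (Set.mem_univ y) hlt]
  · exact heq
  · nlinarith [hm (Set.mem_univ y) (Set.mem_univ x) hlt]

lemma deriv_sub_mul_nonneg (hC : ContDiff ℝ 1 Φ) (x y : ℝ) :
    0 ≤ (deriv Φ x - deriv Φ y) * (x - y) := by
  nlinarith [deriv_tangent_le hC x y, deriv_tangent_le hC y x]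

end NFunction

/-! ### Convergence of series with small tails -/

section Tails

variable {E ι : Type*}

lemma Summable.exists_forall_sum_le {f : E → ℝ} (hf : Summable f) {ε : ℝ} (hε : 0 < ε) :
    ∃ T : Finset E, ∀ T', Disjoint T' T → ∑ e ∈ T', f e ≤ ε := by
  obtain ⟨T, hT⟩ := summable_iff_vanishing_norm.1 hf ε hε
  exact ⟨T, fun T' h => (le_abs_self _).trans (hT T' h).le⟩

lemma abs_tsum_sub_sum_le {g : E → ℝ} (hg : Summable g) {T : Finset E} {ε : ℝ}
    (h : ∀ T', Disjoint T' T → ∑ e ∈ T', |g e| ≤ ε) : |∑' e, g e - ∑ e ∈ T, g e| ≤ ε := by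
  classical
  have ht : Tendsto (fun T'' : Finset E => |∑ e ∈ T'', g e - ∑ e ∈ T, g e|) atTop
      (𝓝 |∑' e, g e - ∑ e ∈ T, g e|) := (hg.hasSum.sub_const _).abs
  refine le_of_tendsto ht ?_
  filter_upwards [eventually_ge_atTop T] with T'' hT
  rw [← Finset.sum_sdiff_eq_sub hT]
  exact (Finset.abs_sum_le_sum_abs _ _).trans (h _ Finset.sdiff_disjoint)

/-- Vitali's convergence theorem for series. -/
lemma tendsto_tsum_of_small_tails {l : Filter ι} [l.NeBot] {g : ι → E → ℝ} {g₀ : E → ℝ}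
    (hlim : ∀ e, Tendsto (fun i => g i e) l (𝓝 (g₀ e))) (hs : ∀ i, Summable (g i))
    (htail : ∀ ε : ℝ, 0 < ε → ∃ T : Finset E, ∀ᶠ i in l, ∀ T', Disjoint T' T →
      ∑ e ∈ T', |g i e| ≤ ε) :
    Tendsto (fun i => ∑' e, g i e) l (𝓝 (∑' e, g₀ e)) := by
  have htail₀ : ∀ ε : ℝ, 0 < ε → ∃ T : Finset E, (∀ T', Disjoint T' T →
      ∑ e ∈ T', |g₀ e| ≤ ε) ∧ ∀ᶠ i in l, ∀ T', Disjoint T' T → ∑ e ∈ T', |g i e| ≤ ε := by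
    intro ε hε
    obtain ⟨T, hT⟩ := htail ε hε
    refine ⟨T, fun T' hd => ?_, hT⟩
    refine le_of_tendsto (tendsto_finsetSum T' fun e _ => (hlim e).abs) ?_
    filter_upwards [hT] with i hi using hi T' hd
  have hs₀ : Summable g₀ := by
    refine summable_iff_vanishing_norm.2 fun ε hε => ?_
    obtain ⟨T, hT, -⟩ := htail₀ (ε / 2) (half_pos hε)
    refine ⟨T, fun T' hd => ?_⟩
    exact ((Finset.abs_sum_le_sum_abs _ _).trans (hT T' hd)).trans_lt (half_lt_self hε)
  refine Metric.tendsto_nhds.2 fun ε hε => ?_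
  obtain ⟨T, hT, hT'⟩ := htail₀ (ε / 4) (by positivity)
  have h3 := Metric.tendsto_nhds.1 (tendsto_finsetSum T fun e _ => hlim e) (ε / 4) (by positivity)
  filter_upwards [hT', h3] with i h1 h2
  have h4 := abs_tsum_sub_sum_le (hs i) h1
  have h5 := abs_tsum_sub_sum_le hs₀ hT
  rw [Real.dist_eq] at h2 ⊢
  rw [abs_le] at h4 h5
  rw [abs_lt] at h2 ⊢
  constructor <;> linarith [h4.1, h4.2, h5.1, h5.2, h2.1, h2.2]

end Tails

/-! ### Functions of finite modular -/

namespace NFunction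

variable {Φ : NFunction} {E ι : Type*}

lemma summable_neg {a : E → ℝ} (ha : Summable fun e => Φ (a e)) :
    Summable fun e => Φ (-a e) := by
  simpa only [Φ.neg] using ha

lemma le_tsum_apply {a : E → ℝ} (ha : Summable fun e => Φ (a e)) (e : E) :
    Φ (a e) ≤ ∑' e, Φ (a e) :=
  ha.le_tsum e fun _ _ => Φ.nonneg _

lemma sum_le_tsum_apply {a : E → ℝ} (ha : Summable fun e => Φ (a e)) (T : Finset E) :
    ∑ e ∈ T, Φ (a e) ≤ ∑' e, Φ (a e) :=
  ha.sum_le_tsum T fun _ _ => Φ.nonneg _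

lemma DeltaTwo.exists_tsum_mul_le (hD : Φ.DeltaTwo) (R c : ℝ) :
    ∃ C : ℝ, 0 < C ∧ ∀ a : E → ℝ, (Summable fun e => Φ (a e)) → ∑' e, Φ (a e) ≤ R →
      (Summable fun e => Φ (c * a e)) ∧ ∑' e, Φ (c * a e) ≤ C * ∑' e, Φ (a e) := by
  obtain ⟨C, hC, h⟩ := hD.exists_mul_le R c
  refine ⟨C, hC, fun a ha haR => ?_⟩
  have hle : ∀ e, Φ (c * a e) ≤ C * Φ (a e) := fun e => h _ ((le_tsum_apply ha e).trans haR)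
  have hs : Summable fun e => Φ (c * a e) :=
    Summable.of_nonneg_of_le (fun _ => Φ.nonneg _) hle (ha.mul_left C)
  refine ⟨hs, ?_⟩
  rw [← tsum_mul_left]
  exact hs.tsum_le_tsum hle (ha.mul_left C)

lemma DeltaTwo.summable_mul (hD : Φ.DeltaTwo) {a : E → ℝ} (ha : Summable fun e => Φ (a e))
    (c : ℝ) : Summable fun e => Φ (c * a e) := by
  obtain ⟨C, -, h⟩ := hD.exists_tsum_mul_le (E := E) (∑' e, Φ (a e)) c
  exact (h a ha le_rfl).1

lemma DeltaTwo.exists_tsum_add_le (hD : Φ.DeltaTwo) (R : ℝ) :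
    ∃ C : ℝ, 0 < C ∧ ∀ a b : E → ℝ, (Summable fun e => Φ (a e)) → ∑' e, Φ (a e) ≤ R →
      (Summable fun e => Φ (b e)) → ∑' e, Φ (b e) ≤ R →
      (Summable fun e => Φ (a e + b e)) ∧ ∑' e, Φ (a e + b e) ≤ C := by
  obtain ⟨C, hC, h⟩ := hD.exists_tsum_mul_le (E := E) R 2
  refine ⟨C * (|R| + 1), by positivity, fun a b ha haR hb hbR => ?_⟩
  obtain ⟨ha2, ha3⟩ := h a ha haR
  obtain ⟨hb2, hb3⟩ := h b hb hbR
  have hs : Summable fun e => Φ (a e + b e) :=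
    Summable.of_nonneg_of_le (fun _ => Φ.nonneg _) (fun e => Φ.convex_half _ _)
      ((ha2.add hb2).mul_left _)
  refine ⟨hs, (hs.tsum_le_tsum (fun e => Φ.convex_half _ _) ((ha2.add hb2).mul_left _)).trans ?_⟩
  rw [tsum_mul_left, ha2.tsum_add hb2]
  have h1 : C * ∑' e, Φ (a e) ≤ C * |R| := by gcongr; exact haR.trans (le_abs_self R)
  have h2 : C * ∑' e, Φ (b e) ≤ C * |R| := by gcongr; exact hbR.trans (le_abs_self R)
  linarith

lemma DeltaTwo.summable_add (hD : Φ.DeltaTwo) {a b : E → ℝ} (ha : Summable fun e => Φ (a e))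
    (hb : Summable fun e => Φ (b e)) : Summable fun e => Φ (a e + b e) := by
  obtain ⟨C, -, h⟩ := hD.exists_tsum_add_le (E := E) (max (∑' e, Φ (a e)) (∑' e, Φ (b e)))
  exact (h a b ha (le_max_left _ _) hb (le_max_right _ _)).1

lemma DeltaTwo.summable_sub (hD : Φ.DeltaTwo) {a b : E → ℝ} (ha : Summable fun e => Φ (a e))
    (hb : Summable fun e => Φ (b e)) : Summable fun e => Φ (a e - b e) := by
  simpa only [sub_eq_add_neg] using hD.summable_add ha (summable_neg hb)

lemma DeltaTwo.exists_tsum_sub_le (hD : Φ.DeltaTwo) (R : ℝ) :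
    ∃ C : ℝ, 0 < C ∧ ∀ a b : E → ℝ, (Summable fun e => Φ (a e)) → ∑' e, Φ (a e) ≤ R →
      (Summable fun e => Φ (b e)) → ∑' e, Φ (b e) ≤ R → ∑' e, Φ (a e - b e) ≤ C := by
  obtain ⟨C, hC, h⟩ := hD.exists_tsum_add_le (E := E) R
  refine ⟨C, hC, fun a b ha haR hb hbR => ?_⟩
  have := (h a (fun e => -b e) ha haR (summable_neg hb) (by simpa only [Φ.neg] using hbR)).2
  simpa only [← sub_eq_add_neg] using this

/-- Fatou's lemma for the modular. -/
lemma summable_of_tendsto {l : Filter ι} [l.NeBot] (hΦ : Continuous Φ) {a : ι → E → ℝ}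
    {a₀ : E → ℝ} (hlim : ∀ e, Tendsto (fun i => a i e) l (𝓝 (a₀ e)))
    (hs : ∀ i, Summable fun e => Φ (a i e)) {R : ℝ} (hR : ∀ i, ∑' e, Φ (a i e) ≤ R) :
    (Summable fun e => Φ (a₀ e)) ∧ ∑' e, Φ (a₀ e) ≤ R := by
  have h : ∀ T : Finset E, ∑ e ∈ T, Φ (a₀ e) ≤ R := fun T =>
    le_of_tendsto (tendsto_finsetSum T fun e _ => (hΦ.tendsto _).comp (hlim e))
      (Eventually.of_forall fun i => (sum_le_tsum_apply (hs i) T).trans (hR i))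
  exact ⟨summable_of_sum_le (fun _ => Φ.nonneg _) h,
    Real.tsum_le_of_sum_le (fun _ => Φ.nonneg _) h⟩

lemma DeltaTwo.summable_deriv_mul (hD : Φ.DeltaTwo) (hC : ContDiff ℝ 1 Φ) {a u : E → ℝ}
    (ha : Summable fun e => Φ (a e)) (hu : Summable fun e => Φ (u e)) :
    Summable fun e => deriv Φ (a e) * u e := by
  refine Summable.of_norm_bounded (g := fun e => (Φ (2 * a e) + Φ (2 * (1 * u e))) / (2 * 1))
    ?_ fun e => abs_deriv_mul_le hC _ _ one_pos
  simp only [one_mul]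
  exact ((hD.summable_mul ha 2).add (hD.summable_mul hu 2)).div_const _

/-- For `a` of finite modular, the functional `u ↦ ∑ Φ'(a) u` is continuous for pointwise
convergence on modular-bounded sets. This is where `∇₂(0)` enters. -/
lemma DeltaTwo.tendsto_tsum_deriv_mul (hD : Φ.DeltaTwo) (hN : Φ.NablaTwo) (hC : ContDiff ℝ 1 Φ)
    {l : Filter ι} [l.NeBot] {a : E → ℝ} (ha : Summable fun e => Φ (a e)) {u : ι → E → ℝ}
    {u₀ : E → ℝ} (hlim : ∀ e, Tendsto (fun i => u i e) l (𝓝 (u₀ e)))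
    (hs : ∀ i, Summable fun e => Φ (u i e)) {R : ℝ} (hR : ∀ i, ∑' e, Φ (u i e) ≤ R) :
    Tendsto (fun i => ∑' e, deriv Φ (a e) * u i e) l (𝓝 (∑' e, deriv Φ (a e) * u₀ e)) := by
  refine tendsto_tsum_of_small_tails (fun e => (hlim e).const_mul _)
    (fun i => hD.summable_deriv_mul hC ha (hs i)) fun ε hε => ?_
  obtain ⟨C, hC0, h2⟩ := hD.exists_tsum_mul_le (E := E) R 2
  obtain ⟨t, ht, hsmall⟩ := hN.exists_mul_le (C * |R|) (ε := ε / (C * |R| + 1)) (by positivity)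
  obtain ⟨T, hT⟩ := (hD.summable_mul ha 2).exists_forall_sum_le (mul_pos ht hε)
  refine ⟨T, Eventually.of_forall fun i T' hd => ?_⟩
  obtain ⟨h2s, h2le⟩ := h2 (u i) (hs i) (hR i)
  have h2R : ∑' e, Φ (2 * u i e) ≤ C * |R| :=
    h2le.trans (by gcongr; exact (hR i).trans (le_abs_self R))
  have hpt : ∀ e, |deriv Φ (a e) * u i e| ≤
      Φ (2 * a e) / (2 * t) + ε / (C * |R| + 1) / 2 * Φ (2 * u i e) := by
    intro e
    refine (abs_deriv_mul_le hC _ _ ht).trans ?_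
    have h3 := hsmall (2 * u i e) ((le_tsum_apply h2s e).trans h2R)
    rw [mul_left_comm] at h3
    rw [add_div]
    gcongr
    rw [div_le_iff₀ (by positivity)]
    linarith
  calc ∑ e ∈ T', |deriv Φ (a e) * u i e|
      ≤ ∑ e ∈ T', (Φ (2 * a e) / (2 * t) + ε / (C * |R| + 1) / 2 * Φ (2 * u i e)) :=
        Finset.sum_le_sum fun e _ => hpt e
    _ = (∑ e ∈ T', Φ (2 * a e)) / (2 * t)
        + ε / (C * |R| + 1) / 2 * ∑ e ∈ T', Φ (2 * u i e) := by
        rw [Finset.sum_add_distrib, Finset.sum_div, Finset.mul_sum]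
    _ ≤ t * ε / (2 * t) + ε / (C * |R| + 1) / 2 * (C * |R| + 1) := by
        have h4 : ∑ e ∈ T', Φ (2 * u i e) ≤ C * |R| + 1 := by
          linarith [sum_le_tsum_apply h2s T']
        have := hT T' hd
        gcongr
    _ = ε := by
        field_simp
        ring

/-- For `u` of finite modular, `a ↦ ∑ Φ'(a) u` is continuous for pointwise convergence on
modular-bounded sets. -/
lemma DeltaTwo.tendsto_tsum_deriv_mul_left (hD : Φ.DeltaTwo) (hC : ContDiff ℝ 1 Φ)
    {l : Filter ι} [l.NeBot] {a : ι → E → ℝ} {a₀ : E → ℝ}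
    (hlim : ∀ e, Tendsto (fun i => a i e) l (𝓝 (a₀ e)))
    (hs : ∀ i, Summable fun e => Φ (a i e)) {R : ℝ} (hR : ∀ i, ∑' e, Φ (a i e) ≤ R)
    {u : E → ℝ} (hu : Summable fun e => Φ (u e)) :
    Tendsto (fun i => ∑' e, deriv Φ (a i e) * u e) l (𝓝 (∑' e, deriv Φ (a₀ e) * u e)) := by
  refine tendsto_tsum_of_small_tails
    (fun e => (((continuous_deriv hC).tendsto _).comp (hlim e)).mul_const _)
    (fun i => hD.summable_deriv_mul hC (hs i) hu) fun ε hε => ?_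
  obtain ⟨C, hC0, h2⟩ := hD.exists_tsum_mul_le (E := E) R 2
  -- A large dilation `t` makes the contribution `C R / 2t` of `a` small.
  obtain ⟨t, ht, htε⟩ : ∃ t : ℝ, 0 < t ∧ C * |R| ≤ t * ε :=
    ⟨C * |R| / ε + 1, by positivity, by rw [add_mul, div_mul_cancel₀ _ hε.ne']; linarith⟩
  obtain ⟨T, hT⟩ := (hD.summable_mul (hD.summable_mul hu t) 2).exists_forall_sum_le (mul_pos ht hε)
  refine ⟨T, Eventually.of_forall fun i T' hd => ?_⟩
  obtain ⟨h2s, h2le⟩ := h2 (a i) (hs i) (hR i)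
  have h2R : ∑' e, Φ (2 * a i e) ≤ C * |R| :=
    h2le.trans (by gcongr; exact (hR i).trans (le_abs_self R))
  calc ∑ e ∈ T', |deriv Φ (a i e) * u e|
      ≤ ∑ e ∈ T', (Φ (2 * a i e) + Φ (2 * (t * u e))) / (2 * t) :=
        Finset.sum_le_sum fun e _ => abs_deriv_mul_le hC _ _ ht
    _ = (∑ e ∈ T', Φ (2 * a i e) + ∑ e ∈ T', Φ (2 * (t * u e))) / (2 * t) := by
        rw [← Finset.sum_div, Finset.sum_add_distrib]
    _ ≤ (t * ε + t * ε) / (2 * t) := by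
        have := hT T' hd
        have := sum_le_tsum_apply h2s T'
        gcongr
        linarith
    _ = ε := by
        field_simp
        ring

/-- The Radon–Riesz property of the modular: pointwise convergence together with convergence of the
modulars implies convergence in modular, for all dilations. -/
lemma DeltaTwo.tendsto_tsum_mul_sub (hD : Φ.DeltaTwo) (hΦ : Continuous Φ)
    {l : Filter ι} [l.NeBot] {a : ι → E → ℝ} {a₀ : E → ℝ}
    (hlim : ∀ e, Tendsto (fun i => a i e) l (𝓝 (a₀ e)))
    (hs : ∀ i, Summable fun e => Φ (a i e)) (hs₀ : Summable fun e => Φ (a₀ e))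
    (hsum : Tendsto (fun i => ∑' e, Φ (a i e)) l (𝓝 (∑' e, Φ (a₀ e)))) (c : ℝ) :
    Tendsto (fun i => ∑' e, Φ (c * (a i e - a₀ e))) l (𝓝 0) := by
  have hd2 : ∀ i, Summable fun e => Φ (1 / 2 * (a i e - a₀ e)) := fun i =>
    hD.summable_mul (hD.summable_sub (hs i) hs₀) _
  have hpt : ∀ i e, Φ (1 / 2 * (a i e - a₀ e)) ≤ 1 / 2 * (Φ (a i e) + Φ (a₀ e)) := by
    intro i e
    have := Φ.convex_half (1 / 2 * a i e) (-(1 / 2 * a₀ e))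
    rw [mul_neg, Φ.neg] at this
    convert this using 4 <;> ring
  have half : Tendsto (fun i => ∑' e, Φ (1 / 2 * (a i e - a₀ e))) l (𝓝 0) := by
    have h0 : (0 : ℝ) = ∑' _ : E, (0 : ℝ) := by simp
    rw [h0]
    refine tendsto_tsum_of_small_tails (fun e => ?_) hd2 fun ε hε => ?_
    · have h1 : Tendsto (fun i => 1 / 2 * (a i e - a₀ e)) l (𝓝 (1 / 2 * (a₀ e - a₀ e))) :=
        ((hlim e).sub_const _).const_mul _
      rw [sub_self, mul_zero] at h1
      have h2 := (hΦ.tendsto 0).comp h1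
      rwa [Φ.zero] at h2
    · obtain ⟨T, hT⟩ := hs₀.exists_forall_sum_le (show 0 < ε / 4 by positivity)
      have hTs : ∑' e, Φ (a₀ e) - ∑ e ∈ T, Φ (a₀ e) ≤ ε / 4 := by
        refine (le_abs_self _).trans (abs_tsum_sub_sum_le hs₀ fun T' hd => ?_)
        simp only [abs_of_nonneg (Φ.nonneg _)]
        exact hT T' hd
      have h1 := tendsto_finsetSum T fun e _ => (hΦ.tendsto _).comp (hlim e)
      have h2 := (hsum.sub h1).eventually_le_const (u := ε / 2) (by linarith)
      refine ⟨T, ?_⟩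
      filter_upwards [h2] with i hi T' hd
      have h3 : ∑ e ∈ T', Φ (a i e) ≤ ε / 2 := by
        have := sum_le_tsum_apply (hs i) (T'.disjUnion T hd)
        rw [Finset.sum_disjUnion] at this
        simp only [Function.comp] at hi
        linarith
      simp only [abs_of_nonneg (Φ.nonneg _)]
      refine (Finset.sum_le_sum fun e _ => hpt i e).trans ?_
      rw [← Finset.mul_sum, Finset.sum_add_distrib]
      linarith [hT T' hd]
  obtain ⟨C, hC, h⟩ := hD.exists_tsum_mul_le (E := E) 1 (2 * c)
  have hle := half.const_mul C
  rw [mul_zero] at hle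
  refine tendsto_of_tendsto_of_tendsto_of_le_of_le' tendsto_const_nhds hle
    (Eventually.of_forall fun i => tsum_nonneg fun _ => Φ.nonneg _) ?_
  filter_upwards [half.eventually_le_const one_pos] with i hi
  have h1 := (h _ (hd2 i) hi).2
  refine (le_of_eq ?_).trans h1
  refine tsum_congr fun e => ?_
  congr 1
  ring

/-- The variational inequality at a minimizer of the modular in a direction `d`. -/
lemma DeltaTwo.tsum_deriv_mul_nonneg_of_le (hD : Φ.DeltaTwo) (hC : ContDiff ℝ 1 Φ)
    {b d : E → ℝ} (hb : Summable fun e => Φ (b e)) (hd : Summable fun e => Φ (d e))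
    (hmin : ∀ t : ℝ, 0 < t → ∑' e, Φ (b e) ≤ ∑' e, Φ (b e + t * d e)) :
    0 ≤ ∑' e, deriv Φ (b e) * d e := by
  let t : ℕ → ℝ := fun n => 1 / ((n : ℝ) + 1)
  have ht : ∀ n, 0 < t n := fun n => by positivity
  have ht1 : ∀ n, t n ≤ 1 := fun n => by
    refine div_le_one_of_le₀ ?_ (by positivity)
    linarith [Nat.cast_nonneg (α := ℝ) n]
  have hts : ∀ n, Summable fun e => Φ (t n * d e) := fun n => hD.summable_mul hd _
  have htd : ∀ n, ∑' e, Φ (t n * d e) ≤ ∑' e, Φ (d e) := fun n =>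
    (hts n).tsum_le_tsum (fun e => (Φ.convex_zero (ht n).le (ht1 n) _).trans
      (mul_le_of_le_one_left (Φ.nonneg _) (ht1 n))) hd
  obtain ⟨R, -, hR⟩ := hD.exists_tsum_add_le (E := E) (max (∑' e, Φ (b e)) (∑' e, Φ (d e)))
  have hR' := fun n => hR b (fun e => t n * d e) hb (le_max_left _ _) (hts n)
    ((htd n).trans (le_max_right _ _))
  have hlim : ∀ e, Tendsto (fun n => b e + t n * d e) atTop (𝓝 (b e)) := fun e => by
    simpa [t] using (tendsto_one_div_add_atTop_nhds_zero_nat.mul_const (d e)).const_add (b e)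
  refine ge_of_tendsto' (hD.tendsto_tsum_deriv_mul_left hC hlim (fun n => (hR' n).1)
    (fun n => (hR' n).2) hd) fun n => ?_
  have hprod : Summable fun e => deriv Φ (b e + t n * d e) * d e :=
    hD.summable_deriv_mul hC (hR' n).1 hd
  have hpt : ∀ e, Φ (b e + t n * d e) ≤
      Φ (b e) + t n * (deriv Φ (b e + t n * d e) * d e) := fun e => by
    have := deriv_tangent_le hC (b e + t n * d e) (b e)
    linarith
  have h1 := (hR' n).1.tsum_le_tsum hpt (hb.add (hprod.mul_left _))
  rw [hb.tsum_add (hprod.mul_left _), tsum_mul_left] at h1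
  have h2 := hmin (t n) (ht n)
  exact nonneg_of_mul_nonneg_right (by linarith) (ht n)

end NFunction

/-! ### Minimizing the modular along an exhaustion -/

namespace NFunction

variable {Φ : NFunction} {E ι : Type*}

lemma orliczModular_eq_ofReal_tsum {a : E → ℝ} (ha : Summable fun e => Φ (a e)) :
    orliczModular Φ a = ENNReal.ofReal (∑' e, Φ (a e)) :=
  (ENNReal.ofReal_tsum_of_nonneg (fun _ => Φ.nonneg _) ha).symm

/-- The modular attains its minimum on a translate of a pointwise closed space `W` of functions of
finite modular: its sublevel sets are compact by Tychonoff's theorem. -/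
lemma DeltaTwo.exists_minimizer (hD : Φ.DeltaTwo) (hΦ : Continuous Φ)
    {W : Submodule ℝ (E → ℝ)} (hW : IsClosed (W : Set (E → ℝ)))
    (hfin : ∀ w ∈ W, Summable fun e => Φ (w e)) {a : E → ℝ} (ha : Summable fun e => Φ (a e)) :
    ∃ v ∈ W, ∀ w ∈ W, ∑' e, Φ (a e + v e) ≤ ∑' e, Φ (a e + w e) := by
  obtain ⟨M, hM, hb⟩ := Φ.exists_abs_le (∑' e, Φ (a e))
  have hbox : ∀ w ∈ W, ∑' e, Φ (a e + w e) ≤ ∑' e, Φ (a e) →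
      w ∈ Set.univ.pi fun e => Set.Icc (-M - a e) (M - a e) := by
    intro w hw hle e _
    have h1 := abs_le.1 (hb _ ((le_tsum_apply (hD.summable_add ha (hfin w hw)) e).trans hle))
    constructor <;> linarith [h1.1, h1.2]
  have hcomp : IsCompact ((W : Set (E → ℝ)) ∩ Set.univ.pi fun e => Set.Icc (-M - a e) (M - a e)) :=
    (isCompact_univ_pi fun e => isCompact_Icc).inter_left hW
  have hne : ((W : Set (E → ℝ)) ∩
      Set.univ.pi fun e => Set.Icc (-M - a e) (M - a e)).Nonempty :=
    ⟨0, W.zero_mem, hbox 0 W.zero_mem (by simp)⟩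
  have hlsc : LowerSemicontinuous fun u : E → ℝ => orliczModular Φ (a + u) := by
    refine lowerSemicontinuous_tsum fun e => Continuous.lowerSemicontinuous ?_
    exact ENNReal.continuous_ofReal.comp (hΦ.comp (continuous_const.add (continuous_apply e)))
  obtain ⟨v, hv, hmin⟩ := (hlsc.lowerSemicontinuousOn _).exists_isMinOn hne hcomp
  have hmin' : ∀ w ∈ W, ∑' e, Φ (a e + w e) ≤ ∑' e, Φ (a e) →
      ∑' e, Φ (a e + v e) ≤ ∑' e, Φ (a e + w e) := by
    intro w hw hle
    have h1 : orliczModular Φ (fun e => a e + v e) ≤ orliczModular Φ (fun e => a e + w e) :=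
      hmin ⟨hw, hbox w hw hle⟩
    rw [orliczModular_eq_ofReal_tsum (hD.summable_add ha (hfin v hv.1)),
      orliczModular_eq_ofReal_tsum (hD.summable_add ha (hfin w hw))] at h1
    exact (ENNReal.ofReal_le_ofReal_iff (tsum_nonneg fun _ => Φ.nonneg _)).1 h1
  refine ⟨v, hv.1, fun w hw => ?_⟩
  rcases le_total (∑' e, Φ (a e + w e)) (∑' e, Φ (a e)) with hle | hle
  · exact hmin' w hw hle
  · refine le_trans ?_ hle
    simpa using hmin' 0 W.zero_mem (by simp)

/-- The Euler–Lagrange equation of a minimizer. -/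
lemma DeltaTwo.tsum_deriv_mul_eq_zero_of_minimizer (hD : Φ.DeltaTwo) (hC : ContDiff ℝ 1 Φ)
    {W : Submodule ℝ (E → ℝ)} (hfin : ∀ w ∈ W, Summable fun e => Φ (w e)) {a v : E → ℝ}
    (ha : Summable fun e => Φ (a e)) (hv : v ∈ W)
    (hmin : ∀ w ∈ W, ∑' e, Φ (a e + v e) ≤ ∑' e, Φ (a e + w e)) {w : E → ℝ} (hw : w ∈ W) :
    ∑' e, deriv Φ (a e + v e) * w e = 0 := by
  have hnn : ∀ w ∈ W, 0 ≤ ∑' e, deriv Φ (a e + v e) * w e := by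
    intro w hw
    refine hD.tsum_deriv_mul_nonneg_of_le hC (hD.summable_add ha (hfin v hv)) (hfin w hw)
      fun t _ => ?_
    simpa [add_assoc] using hmin _ (W.add_mem hv (W.smul_mem t hw))
  refine le_antisymm ?_ (hnn w hw)
  simpa [tsum_neg] using hnn _ (W.neg_mem hw)

/-- Let `W i` be an increasing family of pointwise closed spaces of functions of finite modular.
The minimizers of the modular on `a + W i` converge, along some filter, pointwise and in modular to
a function that is critical in all directions from `⋃ i, W i`.

The filter is an ultrafilter, along which the modular-bounded minimizers converge pointwise. The
subgradient inequalities between a minimizer and the limit, together with the two continuity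
statements for the pairing `∑ Φ'(a) u`, give convergence of the modulars. -/
theorem DeltaTwo.exists_tendsto_critical (hD : Φ.DeltaTwo) (hN : Φ.NablaTwo)
    (hC : ContDiff ℝ 1 Φ) [Preorder ι] [IsDirectedOrder ι] [Nonempty ι]
    {W : ι → Submodule ℝ (E → ℝ)} (hmono : Monotone W)
    (hW : ∀ i, IsClosed (W i : Set (E → ℝ)))
    (hfin : ∀ i, ∀ w ∈ W i, Summable fun e => Φ (w e)) {a : E → ℝ}
    (ha : Summable fun e => Φ (a e)) :
    ∃ (l : Filter ι) (_ : l.NeBot) (v : ι → E → ℝ) (b : E → ℝ), (∀ i, v i ∈ W i) ∧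
      (Summable fun e => Φ (b e)) ∧ (∀ e, Tendsto (fun i => a e + v i e) l (𝓝 (b e))) ∧
      (∀ c : ℝ, Tendsto (fun i => ∑' e, Φ (c * (a e + v i e - b e))) l (𝓝 0)) ∧
      ∀ i, ∀ w ∈ W i, ∑' e, deriv Φ (b e) * w e = 0 := by
  choose v hv hmin using fun i => hD.exists_minimizer hC.continuous (hW i) (hfin i) ha
  have hEL : ∀ i, ∀ w ∈ W i, ∑' e, deriv Φ (a e + v i e) * w e = 0 := fun i w hw =>
    hD.tsum_deriv_mul_eq_zero_of_minimizer hC (hfin i) ha (hv i) (hmin i) hw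
  have hs : ∀ i, Summable fun e => Φ (a e + v i e) := fun i =>
    hD.summable_add ha (hfin i _ (hv i))
  set R := ∑' e, Φ (a e) with hRdef
  have hR : ∀ i, ∑' e, Φ (a e + v i e) ≤ R := fun i => by
    simpa using hmin i 0 (W i).zero_mem
  let 𝒰 : Ultrafilter ι := Ultrafilter.of atTop
  have h𝒰 : (𝒰 : Filter ι) ≤ atTop := Ultrafilter.of_le atTop
  obtain ⟨M, hM, hbd⟩ := Φ.exists_abs_le R
  have hlim : ∀ e, ∃ y, Tendsto (fun i => a e + v i e) 𝒰 (𝓝 y) := by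
    intro e
    have hmem : ∀ i, a e + v i e ∈ Set.Icc (-M) M := fun i =>
      abs_le.1 (hbd _ ((le_tsum_apply (hs i) e).trans (hR i)))
    obtain ⟨y, -, hy⟩ := isCompact_Icc.ultrafilter_le_nhds (𝒰.map fun i => a e + v i e)
      (le_principal_iff.2 (mem_map.2 (univ_mem' hmem)))
    exact ⟨y, hy⟩
  choose b hb using hlim
  obtain ⟨hbs, hbR⟩ := summable_of_tendsto hC.continuous hb hs hR
  have hcrit : ∀ i, ∀ w ∈ W i, ∑' e, deriv Φ (b e) * w e = 0 := by
    intro i w hw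
    refine tendsto_nhds_unique_of_eventuallyEq
      (hD.tendsto_tsum_deriv_mul_left hC hb hs hR (hfin i w hw)) tendsto_const_nhds ?_
    filter_upwards [h𝒰 (eventually_ge_atTop i)] with j hj using hEL j w (hmono hj hw)
  have hba : Summable fun e => Φ (b e - a e) := hD.summable_sub hbs ha
  -- The limit is critical in the direction of the weak limit `b - a` of the `v i`.
  have hself : ∑' e, deriv Φ (b e) * (b e - a e) = 0 := by
    obtain ⟨C, -, hCle⟩ := hD.exists_tsum_sub_le (E := E) R
    have hvs : ∀ i, Summable fun e => Φ (a e + v i e - a e) := fun i =>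
      hD.summable_sub (hs i) ha
    have h1 := hD.tendsto_tsum_deriv_mul hN hC hbs (fun e => (hb e).sub_const (a e)) hvs
      fun i => hCle _ _ (hs i) (hR i) ha le_rfl
    refine tendsto_nhds_unique_of_eventuallyEq h1 tendsto_const_nhds
      (Eventually.of_forall fun i => ?_)
    simpa using hcrit i _ (hv i)
  have hsum : Tendsto (fun i => ∑' e, Φ (a e + v i e)) 𝒰 (𝓝 (∑' e, Φ (b e))) := by
    have hpair := hD.tendsto_tsum_deriv_mul_left hC hb hs hR hba
    rw [hself] at hpair
    have hlow := hpair.const_sub (∑' e, Φ (b e))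
    rw [sub_zero] at hlow
    have hprod : ∀ {x y : E → ℝ}, (Summable fun e => Φ (x e)) → (Summable fun e => Φ (y e)) →
        ∑' e, Φ (x e) + ∑' e, deriv Φ (x e) * (y e - x e) ≤ ∑' e, Φ (y e) := by
      intro x y hx hy
      have h1 := hD.summable_deriv_mul hC hx (hD.summable_sub hy hx)
      rw [← hx.tsum_add h1]
      exact (hx.add h1).tsum_le_tsum (fun e => deriv_tangent_le hC _ _) hy
    -- The tangent at the limit: its linear term vanishes because `b` is critical.
    have hge : Tendsto (fun i => ∑' e, Φ (b e) + ∑' e, deriv Φ (b e) * (a e + v i e - b e)) 𝒰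
        (𝓝 (∑' e, Φ (b e))) := by
      have hx : ∀ i, ∑' e, deriv Φ (b e) * (a e + v i e - b e) = 0 := by
        intro i
        have h1 := hcrit i _ (hv i)
        have h2 := (hD.summable_deriv_mul hC hbs (hfin i _ (hv i))).tsum_sub
          (hD.summable_deriv_mul hC hbs hba)
        rw [h1, hself, sub_zero] at h2
        rw [← h2]
        exact tsum_congr fun e => by ring
      simp only [hx, add_zero]
      exact tendsto_const_nhds
    -- The tangent at a minimizer: the part of its linear term along `v i` vanishes, and the rest
    -- tends to `∑ Φ'(b) (b - a) = 0`.
    have hle : ∀ i, ∑' e, Φ (a e + v i e)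
        + ∑' e, deriv Φ (a e + v i e) * (b e - a e) ≤ ∑' e, Φ (b e) := by
      intro i
      refine le_of_eq_of_le ?_ (hprod (hs i) hbs)
      have h1 := hEL i _ (hv i)
      have h2 := (hD.summable_deriv_mul hC (hs i) hba).tsum_sub
        (hD.summable_deriv_mul hC (hs i) (hfin i _ (hv i)))
      rw [h1, sub_zero] at h2
      rw [← h2]
      congr 1
      exact tsum_congr fun e => by ring
    exact tendsto_of_tendsto_of_tendsto_of_le_of_le hge hlow
      (fun i => hprod hbs (hs i)) fun i => by
        have := hle i
        simp only
        linarith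
  exact ⟨𝒰, inferInstance, v, b, hv, hbs, hb,
    hD.tendsto_tsum_mul_sub hC.continuous hb hs hbs hsum, hcrit⟩

end NFunction

/-! ### The Orlicz space and its modular -/

section OrliczSpace

variable {Φ : NFunction} {X ι : Type*}

lemma NFunction.summable_of_orliczModular_lt_top {f : X → ℝ} (h : orliczModular Φ f < ⊤) :
    Summable fun x => Φ (f x) := by
  have := ENNReal.summable_toReal h.ne
  simpa only [ENNReal.toReal_ofReal (Φ.nonneg _)] using this

lemma NFunction.DeltaTwo.mem_orliczSubmodule_iff (hD : Φ.DeltaTwo) {f : X → ℝ} :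
    f ∈ orliczSubmodule Φ X ↔ Summable fun x => Φ (f x) := by
  constructor
  · rintro ⟨a, ha, h⟩
    have h1 := hD.summable_mul (NFunction.summable_of_orliczModular_lt_top h) a⁻¹
    simpa [ha.ne'] using h1
  · intro h
    refine ⟨1, one_pos, ?_⟩
    rw [one_smul, NFunction.orliczModular_eq_ofReal_tsum h]
    exact ENNReal.ofReal_lt_top

namespace OrliczSpace

lemma summable_val (hD : Φ.DeltaTwo) (u : OrliczSpace Φ X) : Summable fun x => Φ (val Φ u x) :=
  hD.mem_orliczSubmodule_iff.1 u.2

/-- Convergence to zero of the modulars of all dilations implies convergence to zero in norm. -/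
lemma tendsto_zero_of_modular (hD : Φ.DeltaTwo) {l : Filter ι} {u : ι → OrliczSpace Φ X}
    (h : ∀ c : ℝ, Tendsto (fun i => ∑' x, Φ (c * val Φ (u i) x)) l (𝓝 0)) :
    Tendsto u l (𝓝 0) := by
  rw [tendsto_zero_iff_norm_tendsto_zero]
  refine Metric.tendsto_nhds.2 fun ε hε => ?_
  filter_upwards [(h (ε / 2)⁻¹).eventually_le_const one_pos] with i hi
  have hle : ‖u i‖ ≤ ε / 2 := by
    refine csInf_le (gaugeSet_bddBelow Φ _) ⟨half_pos hε, ?_⟩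
    have h1 := NFunction.orliczModular_eq_ofReal_tsum
      (hD.summable_mul (summable_val hD (u i)) (ε / 2)⁻¹)
    exact h1.trans_le (ENNReal.ofReal_le_one.2 hi)
  rw [dist_zero_right, norm_norm]
  linarith

/-- The functional `u ↦ ∑ Φ'(a) u` on `ℓ^Φ(X)`, for `a` of finite modular. It is bounded by the
Young inequality. -/
noncomputable def derivPairing (hD : Φ.DeltaTwo) (hC : ContDiff ℝ 1 Φ) (a : X → ℝ)
    (ha : Summable fun x => Φ (a x)) : OrliczSpace Φ X →L[ℝ] ℝ :=
  LinearMap.mkContinuous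
    { toFun := fun u => ∑' x, deriv Φ (a x) * val Φ u x
      map_add' := fun u w => by
        rw [← (hD.summable_deriv_mul hC ha (summable_val hD u)).tsum_add
          (hD.summable_deriv_mul hC ha (summable_val hD w))]
        exact tsum_congr fun x => by rw [map_add, Pi.add_apply, mul_add]
      map_smul' := fun c u => by
        rw [RingHom.id_apply, smul_eq_mul, ← tsum_mul_left]
        refine tsum_congr fun x => ?_
        rw [map_smul, Pi.smul_apply, smul_eq_mul]
        ring }
    (∑' x, Φ (2 * a x) + 1) <| by
    intro u
    have hA : 0 < ∑' x, Φ (2 * a x) + 1 := by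
      have : 0 ≤ ∑' x, Φ (2 * a x) := tsum_nonneg fun _ => Φ.nonneg _
      linarith
    change |∑' x, deriv Φ (a x) * val Φ u x| ≤ _
    rw [← div_le_iff₀' hA]
    refine le_csInf (gaugeSet_nonempty Φ u.2) ?_
    rintro k ⟨hk, hk'⟩
    have hs : Summable fun x => Φ (k⁻¹ * val Φ u x) := hD.summable_mul (summable_val hD u) _
    have hs1 : ∑' x, Φ (k⁻¹ * val Φ u x) ≤ 1 := by
      have h1 := NFunction.orliczModular_eq_ofReal_tsum hs
      rw [← ENNReal.ofReal_le_one, ← h1]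
      exact hk'
    have h2a := hD.summable_mul ha 2
    rw [div_le_iff₀' hA]
    have hpt : ∀ x, |deriv Φ (a x) * val Φ u x| ≤
        (Φ (2 * a x) + Φ (k⁻¹ * val Φ u x)) * k := by
      intro x
      have h1 := NFunction.abs_deriv_mul_le hC (a x) (val Φ u x)
        (show 0 < (2 * k)⁻¹ by positivity)
      convert h1 using 1
      have e : 2 * ((2 * k)⁻¹ * val Φ u x) = k⁻¹ * val Φ u x := by field_simp
      rw [e]
      field_simp
    have hprod := hD.summable_deriv_mul hC ha (summable_val hD u)
    calc |∑' x, deriv Φ (a x) * val Φ u x|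
        ≤ ∑' x, |deriv Φ (a x) * val Φ u x| := by
          simpa only [Real.norm_eq_abs] using norm_tsum_le_tsum_norm hprod.norm
      _ ≤ ∑' x, (Φ (2 * a x) + Φ (k⁻¹ * val Φ u x)) * k :=
          hprod.abs.tsum_le_tsum hpt ((h2a.add hs).mul_right k)
      _ = (∑' x, Φ (2 * a x) + ∑' x, Φ (k⁻¹ * val Φ u x)) * k := by
          rw [tsum_mul_right, h2a.tsum_add hs]
      _ ≤ (∑' x, Φ (2 * a x) + 1) * k := by gcongr

end OrliczSpace

end OrliczSpace

/-! ### Gradients and Green's formula -/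

lemma summable_prod_iff_of_nonneg {σ X : Type*} [Fintype σ] {F : σ × X → ℝ} (hF : ∀ e, 0 ≤ F e) :
    Summable F ↔ ∀ s, Summable fun x => F (s, x) := by
  rw [summable_prod_of_nonneg hF]
  exact and_iff_left (hasSum_fintype _).summable

lemma tsum_slice_le {σ X : Type*} [Fintype σ] {F : σ × X → ℝ} (hF : ∀ e, 0 ≤ F e)
    (hs : Summable F) (s : σ) :
    ∑' x, F (s, x) ≤ ∑' e, F e := by
  rw [hs.tsum_prod]
  exact (Finset.single_le_sum (f := fun s => ∑' x, F (s, x))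
    (fun s _ => tsum_nonneg fun x => hF _) (Finset.mem_univ s)).trans_eq (tsum_fintype _).symm

section Gradient

variable {G X : Type*} [Group G] [MulAction G X] {Φ : NFunction} {S : Finset G}

/-- The gradient of `f` along the generators `S`: its value at `(s, x)` is `f(s⁻¹ x) - f(x)`. -/
def edgeGradient (S : Finset G) : (X → ℝ) →ₗ[ℝ] (S × X → ℝ) where
  toFun f e := f ((e.1 : G)⁻¹ • e.2) - f e.2
  map_add' f h := by
    ext e
    simp only [Pi.add_apply]
    ring
  map_smul' c f := by
    ext e
    simp only [Pi.smul_apply, smul_eq_mul, RingHom.id_apply]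
    ring

lemma edgeGradient_apply (f : X → ℝ) (s : S) (x : X) :
    edgeGradient S f (s, x) = f ((s : G)⁻¹ • x) - f x := rfl

lemma summable_smul_iff (g : G) {f : X → ℝ} :
    (Summable fun x => f (g • x)) ↔ Summable f :=
  (MulAction.toPerm g : Equiv.Perm X).summable_iff

lemma tsum_smul_eq (g : G) (f : X → ℝ) : ∑' x, f (g • x) = ∑' x, f x :=
  (MulAction.toPerm g : Equiv.Perm X).tsum_eq f

lemma NFunction.DeltaTwo.summable_gradient (hD : Φ.DeltaTwo) {v : X → ℝ}
    (hv : Summable fun x => Φ (v x)) : Summable fun e => Φ (edgeGradient S v e) :=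
  (summable_prod_iff_of_nonneg fun _ => Φ.nonneg _).2 fun s =>
    hD.summable_sub ((summable_smul_iff (f := fun x => Φ (v x)) (s : G)⁻¹).2 hv) hv

/-- Since `S` generates `G`, finiteness of the modular of the gradient along `S` suffices for `f` to
be Dirichlet finite. -/
lemma NFunction.DeltaTwo.mem_dirichletSpace_iff (hD : Φ.DeltaTwo)
    (hS : Subgroup.closure (S : Set G) = ⊤) {f : X → ℝ} :
    f ∈ dirichletSpace G Φ X ↔ Summable fun e => Φ (edgeGradient S f e) := by
  rw [summable_prod_iff_of_nonneg fun _ => Φ.nonneg _]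
  constructor
  · intro h s
    exact hD.mem_orliczSubmodule_iff.1 (h s)
  · intro h g
    have hg : g ∈ Subgroup.closure (S : Set G) := hS ▸ Subgroup.mem_top g
    induction hg using Subgroup.closure_induction with
    | mem s hs => exact hD.mem_orliczSubmodule_iff.2 (h ⟨s, hs⟩)
    | one => simp
    | mul g k _ _ hg hk =>
      have := add_mem hg (permutationRep_mem_orlicz G Φ g hk)
      rw [map_sub] at this
      rw [map_mul, Module.End.mul_apply]
      convert this using 1
      abel
    | inv g _ hg =>
      have := neg_mem (permutationRep_mem_orlicz G Φ g⁻¹ hg)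
      rw [map_sub, ← Module.End.mul_apply, ← map_mul, inv_mul_cancel, map_one, neg_sub] at this
      exact this

/-- Green's formula. The edges `(s, x)` and `(s⁻¹, s⁻¹ x)` carry opposite gradients, and `Φ'` is odd,
whence the factor `-2`. -/
lemma NFunction.DeltaTwo.tsum_deriv_gradient_mul (hD : Φ.DeltaTwo) (hC : ContDiff ℝ 1 Φ)
    (hsymm : ∀ s ∈ S, s⁻¹ ∈ S) {h v : X → ℝ} (hh : Summable fun e => Φ (edgeGradient S h e))
    (hv : Summable fun x => Φ (v x)) :
    ∑' e, deriv Φ (edgeGradient S h e) * edgeGradient S v e =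
      -2 * ∑' x, v x * orliczLaplacian Φ S h x := by
  have hsl := (summable_prod_iff_of_nonneg fun _ => Φ.nonneg _).1 hh
  let D : G → ℝ := fun s => ∑' x, deriv Φ (h (s⁻¹ • x) - h x) * v x
  have hDs : ∀ s ∈ S, Summable fun x => deriv Φ (h (s⁻¹ • x) - h x) * v x := fun s hs =>
    hD.summable_deriv_mul hC (hsl ⟨s, hs⟩) hv
  have hslice : ∀ s : S, ∑' x, deriv Φ (edgeGradient S h (s, x)) * edgeGradient S v (s, x)
      = -D (s : G)⁻¹ - D s := by
    intro s
    have h1 := hDs s s.2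
    have h2 : Summable fun x => deriv Φ (h ((s : G)⁻¹ • x) - h x) * v ((s : G)⁻¹ • x) :=
      hD.summable_deriv_mul hC (hsl s)
        ((summable_smul_iff (f := fun x => Φ (v x)) (s : G)⁻¹).2 hv)
    simp only [edgeGradient_apply, mul_sub]
    rw [h2.tsum_sub h1, ← tsum_smul_eq (s : G), ← tsum_neg]
    congr 1
    refine tsum_congr fun x => ?_
    rw [inv_smul_smul, inv_inv, ← neg_sub (h ((s : G) • x)), NFunction.deriv_neg_arg, neg_mul]
  have hlap : ∑' x, v x * orliczLaplacian Φ S h x = ∑ s ∈ S, D s := by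
    simp only [D]
    rw [← Summable.tsum_finsetSum hDs]
    refine tsum_congr fun x => ?_
    rw [orliczLaplacian, mul_comm, Finset.sum_mul]
  have hinv : ∑ s ∈ S, D s⁻¹ = ∑ s ∈ S, D s :=
    Finset.sum_nbij' (fun s => s⁻¹) (fun s => s⁻¹) hsymm hsymm (by simp) (by simp) (by simp)
  rw [(hD.summable_deriv_mul hC hh (hD.summable_gradient hv)).tsum_prod, tsum_fintype]
  simp only [hslice]
  rw [Finset.sum_coe_sort S fun s => -D s⁻¹ - D s, Finset.sum_sub_distrib,
    Finset.sum_neg_distrib, hinv, hlap]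
  ring

end Gradient

/-! ### Cocycles -/

section Cocycle

variable {G X : Type*} [Group G] [MulAction G X]

/-- For a free action, every cocycle with values in the space of all functions is the coboundary of a
function: on each orbit, integrate the cocycle from a base point. -/
lemma exists_primitive (hfree : ∀ (g : G) (x : X), g • x = x → g = 1) (b : G → X → ℝ)
    (hb : ∀ g h x, b (g * h) x = b g x + b h (g⁻¹ • x)) :
    ∃ f : X → ℝ, ∀ g x, b g x = f (g⁻¹ • x) - f x := by
  let r : X → X := fun x => (Quotient.mk (MulAction.orbitRel G X) x).out
  have hr : ∀ (g : G) x, r (g • x) = r x := fun g x =>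
    congrArg Quotient.out (Quotient.sound (MulAction.orbitRel_apply.2 ⟨g, rfl⟩))
  have hk : ∀ x, ∃ k : G, k • r x = x := fun x => by
    obtain ⟨k, hk⟩ := MulAction.orbitRel_apply.1
      (Quotient.exact (Quotient.out_eq (Quotient.mk (MulAction.orbitRel G X) x)))
    exact ⟨k⁻¹, inv_smul_eq_iff.2 hk.symm⟩
  choose k hk using hk
  have hkg : ∀ (g : G) x, k (g⁻¹ • x) = g⁻¹ * k x := by
    intro g x
    have h1 := hk (g⁻¹ • x)
    rw [hr] at h1
    have h2 : ((g⁻¹ * k x)⁻¹ * k (g⁻¹ • x)) • r x = r x := by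
      rw [mul_smul, h1, inv_smul_eq_iff, mul_smul, hk]
    exact (inv_mul_eq_one.1 (hfree _ _ h2)).symm
  refine ⟨fun x => b (k x)⁻¹ (r x), fun g x => ?_⟩
  simp only [hkg, hr, mul_inv_rev, inv_inv, hb, hk]
  ring

variable {Φ : NFunction} {ι : Type*} {S : Finset G}

lemma norm_orliczRep (g : G) (u : OrliczSpace Φ X) : ‖orliczRep G Φ X g u‖ = ‖u‖ := by
  change OrliczSpace.gaugeNorm Φ (permutationRep G X g (OrliczSpace.val Φ u)) =
    OrliczSpace.gaugeNorm Φ (OrliczSpace.val Φ u)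
  simp only [OrliczSpace.gaugeNorm, ← map_smul, orliczModular_permutationRep]

lemma tendsto_orliczRep (g : G) {l : Filter ι} {u : ι → OrliczSpace Φ X} {u₀ : OrliczSpace Φ X}
    (h : Tendsto u l (𝓝 u₀)) :
    Tendsto (fun i => orliczRep G Φ X g (u i)) l (𝓝 (orliczRep G Φ X g u₀)) := by
  rw [tendsto_iff_norm_sub_tendsto_zero] at h ⊢
  simpa only [← map_sub, norm_orliczRep] using h

variable [TopologicalSpace G] [DiscreteTopology G]

/-- Cocycles on a discrete group converge as soon as they converge on a generating set. -/
lemma tendsto_cocyclesOne (hS : Subgroup.closure (S : Set G) = ⊤) {l : Filter ι}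
    {b : ι → cocyclesOne (orliczRep G Φ X)} {b₀ : cocyclesOne (orliczRep G Φ X)}
    (h : ∀ s ∈ S, Tendsto (fun i => (b i).1 s) l (𝓝 (b₀.1 s))) : Tendsto b l (𝓝 b₀) := by
  rw [tendsto_subtype_rng, ContinuousMap.homeoFnOfDiscrete.isEmbedding.tendsto_nhds_iff,
    tendsto_pi_nhds]
  intro g
  change Tendsto (fun i => (b i).1 g) l (𝓝 (b₀.1 g))
  have hone : ∀ c : cocyclesOne (orliczRep G Φ X), c.1 1 = 0 := fun c => by
    simpa using c.2 1 1
  have hinv : ∀ (c : cocyclesOne (orliczRep G Φ X)) (g : G),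
      c.1 g⁻¹ = -orliczRep G Φ X g⁻¹ (c.1 g) := fun c g => by
    have := c.2 g⁻¹ g
    rw [inv_mul_cancel, hone] at this
    exact eq_neg_of_add_eq_zero_left this.symm
  have hg : g ∈ Subgroup.closure (S : Set G) := hS ▸ Subgroup.mem_top g
  induction hg using Subgroup.closure_induction with
  | mem s hs => exact h s hs
  | one =>
    simp only [hone]
    exact tendsto_const_nhds
  | mul g k _ _ hg hk =>
    rw [b₀.2 g k]
    simp only [fun i => (b i).2 g k]
    exact hg.add (tendsto_orliczRep g hk)
  | inv g _ hg =>
    simp only [hinv]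
    exact (tendsto_orliczRep g⁻¹ hg).neg

end Cocycle

/-! ### Harmonic representatives of reduced cohomology classes -/

section Main

variable {G X : Type*} [Group G] [MulAction G X] {Φ : NFunction} {S : Finset G}

/-- If the gradients along generators of functions `f i` converge pointwise, the limit is again a
gradient. -/
lemma exists_edgeGradient_eq_of_tendsto (hfree : ∀ (g : G) (x : X), g • x = x → g = 1)
    (hS : Subgroup.closure (S : Set G) = ⊤) {ι : Type*} {l : Filter ι} [l.NeBot]
    {f : ι → X → ℝ} {b : S × X → ℝ}
    (hb : ∀ e, Tendsto (fun i => edgeGradient S (f i) e) l (𝓝 (b e))) :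
    ∃ h : X → ℝ, edgeGradient S h = b := by
  have hlim : ∀ (g : G) (x : X), ∃ y, Tendsto (fun i => f i (g⁻¹ • x) - f i x) l (𝓝 y) := by
    intro g
    have hg : g ∈ Subgroup.closure (S : Set G) := hS ▸ Subgroup.mem_top g
    induction hg using Subgroup.closure_induction with
    | mem s hs => exact fun x => ⟨b (⟨s, hs⟩, x), hb (⟨s, hs⟩, x)⟩
    | one => exact fun x => ⟨0, by simp⟩
    | mul g k _ _ hg hk =>
      intro x
      obtain ⟨y, hy⟩ := hg x
      obtain ⟨z, hz⟩ := hk (g⁻¹ • x)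
      refine ⟨y + z, (hy.add hz).congr fun i => ?_⟩
      rw [mul_inv_rev, mul_smul]
      ring
    | inv g _ hg =>
      intro x
      obtain ⟨y, hy⟩ := hg (g • x)
      refine ⟨-y, hy.neg.congr fun i => ?_⟩
      rw [inv_smul_smul, inv_inv]
      ring
  choose c hc using hlim
  obtain ⟨h, hh⟩ := exists_primitive hfree c fun g k x => by
    refine tendsto_nhds_unique (hc (g * k) x)
      (((hc g x).add (hc k (g⁻¹ • x))).congr fun i => ?_)
    rw [mul_inv_rev, mul_smul]
    ring
  refine ⟨h, funext fun e => ?_⟩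
  exact (hh e.1 e.2).symm.trans (tendsto_nhds_unique (hc e.1 e.2) (hb e))

/-- Functions with the same gradient along generators differ by an invariant function. -/
lemma sub_smul_eq_of_edgeGradient_eq (hS : Subgroup.closure (S : Set G) = ⊤) {f h : X → ℝ}
    (hfh : edgeGradient S f = edgeGradient S h) (g : G) (x : X) :
    f (g • x) - h (g • x) = f x - h x := by
  have hg : g ∈ Subgroup.closure (S : Set G) := hS ▸ Subgroup.mem_top g
  induction hg using Subgroup.closure_induction generalizing x with
  | mem s hs =>
    have := congrFun hfh (⟨s, hs⟩, s • x)
    rw [edgeGradient_apply, edgeGradient_apply, inv_smul_smul] at this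
    linarith
  | one => simp
  | mul g k _ _ hg hk => rw [mul_smul, hg, hk]
  | inv g _ hg => rw [← hg (g⁻¹ • x), smul_inv_smul]

variable [TopologicalSpace G] [DiscreteTopology G]

lemma dirichletCocycle_mem_coboundariesOne {v : dirichletSpace G Φ X}
    (hv : v.1 ∈ orliczSubmodule Φ X) :
    dirichletCocycle Φ v ∈ coboundariesOne (orliczRep G Φ X) :=
  ⟨⟨v.1, hv⟩, fun _ => rfl⟩

lemma dirichletCocycle_surjective (hfree : ∀ (g : G) (x : X), g • x = x → g = 1) :
    Function.Surjective (dirichletCocycle Φ : dirichletSpace G Φ X → _) := by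
  intro b
  obtain ⟨f, hf⟩ := exists_primitive hfree (fun g => OrliczSpace.val Φ (b.1 g)) fun g h x => by
    rw [b.2 g h, map_add]
    rfl
  have hf' : ∀ g : G, permutationRep G X g f - f = OrliczSpace.val Φ (b.1 g) := fun g =>
    funext fun x => (hf g x).symm
  refine ⟨⟨f, fun g => hf' g ▸ (b.1 g).2⟩, ?_⟩
  exact Subtype.ext (ContinuousMap.ext fun g => Subtype.ext (hf' g))

/-- Existence: modulo the closure of `B¹`, every Dirichlet finite function is harmonic. -/
lemma exists_harmonic (hfree : ∀ (g : G) (x : X), g • x = x → g = 1)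
    (hS : Subgroup.closure (S : Set G) = ⊤) (hsymm : ∀ s ∈ S, s⁻¹ ∈ S) (hD : Φ.DeltaTwo)
    (hN : Φ.NablaTwo) (hC : ContDiff ℝ 1 Φ) (f : dirichletSpace G Φ X) :
    ∃ h ∈ harmonicFunctions Φ S X,
      dirichletCocycle Φ f - dirichletCocycle Φ h ∈
        (coboundariesOne (orliczRep G Φ X)).topologicalClosure := by
  classical
  let δ : X → X → ℝ := fun x => Pi.single x 1
  have hδ : ∀ x, Summable fun y => Φ (δ x y) := fun x =>
    summable_of_ne_finset_zero (s := {x}) fun y hy => by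
      rw [Finset.mem_singleton] at hy
      simp [δ, Pi.single_eq_of_ne hy, Φ.zero]
  let W : Finset X → Submodule ℝ (S × X → ℝ) := fun A =>
    Submodule.span ℝ ((fun x => edgeGradient S (δ x)) '' A)
  have hWmono : Monotone W := fun A B hAB =>
    Submodule.span_mono (Set.image_mono (Finset.coe_subset.2 hAB))
  have hWclosed : ∀ A, IsClosed (W A : Set (S × X → ℝ)) := fun A => by
    have : FiniteDimensional ℝ (W A) :=
      FiniteDimensional.span_of_finite ℝ (A.finite_toSet.image _)
    exact Submodule.closed_of_finiteDimensional _
  have hWgrad : ∀ A, ∀ w ∈ W A, ∃ v ∈ orliczSubmodule Φ X, edgeGradient S v = w := by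
    intro A w hw
    have hle : W A ≤ (orliczSubmodule Φ X).map (edgeGradient S) := by
      refine Submodule.span_le.2 ?_
      rintro _ ⟨x, -, rfl⟩
      exact ⟨δ x, hD.mem_orliczSubmodule_iff.2 (hδ x), rfl⟩
    exact hle hw
  have hWfin : ∀ A, ∀ w ∈ W A, Summable fun e => Φ (w e) := by
    intro A w hw
    obtain ⟨v, hv, rfl⟩ := hWgrad A w hw
    exact hD.summable_gradient (hD.mem_orliczSubmodule_iff.1 hv)
  obtain ⟨l, hl, v, b, hv, hbs, hlim, hmod, hcrit⟩ := hD.exists_tendsto_critical hN hC hWmono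
    hWclosed hWfin ((hD.mem_dirichletSpace_iff hS).1 f.2)
  choose p hp hpv using fun i => hWgrad i _ (hv i)
  obtain ⟨h, rfl⟩ := exists_edgeGradient_eq_of_tendsto (f := fun i => f.1 + p i) (b := b) hfree hS
    fun e => by simpa only [map_add, Pi.add_apply, hpv] using hlim e
  have hhD : h ∈ dirichletSpace G Φ X := (hD.mem_dirichletSpace_iff hS).2 hbs
  refine ⟨⟨h, hhD⟩, fun x => ?_, ?_⟩
  · -- Green's formula for the Dirac function at `x` gives the Laplacian at `x`.
    have h1 := hcrit {x} (edgeGradient S (δ x))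
      (Submodule.subset_span ⟨x, by simp, rfl⟩)
    rw [hD.tsum_deriv_gradient_mul hC hsymm hbs (hδ x),
      tsum_eq_single x fun y hy => by simp [δ, Pi.single_eq_of_ne hy]] at h1
    simpa [δ] using h1
  · have hpD : ∀ i, p i ∈ dirichletSpace G Φ X := fun i => by
      rw [hD.mem_dirichletSpace_iff hS, hpv]
      exact hWfin i _ (hv i)
    have hconv : Tendsto (fun i => -dirichletCocycle Φ ⟨p i, hpD i⟩) l
        (𝓝 (dirichletCocycle Φ f - dirichletCocycle Φ ⟨h, hhD⟩)) := by
      refine tendsto_cocyclesOne hS fun s hs => ?_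
      rw [← tendsto_sub_nhds_zero_iff]
      refine OrliczSpace.tendsto_zero_of_modular hD fun c => ?_
      have hdiff : ∀ i, Summable fun e =>
          Φ (c * (edgeGradient S f.1 e + v i e - edgeGradient S h e)) := fun i =>
        hD.summable_mul (hD.summable_sub (hD.summable_add
          ((hD.mem_dirichletSpace_iff hS).1 f.2) (hWfin i _ (hv i))) hbs) c
      refine tendsto_of_tendsto_of_tendsto_of_le_of_le tendsto_const_nhds (hmod c)
        (fun i => tsum_nonneg fun _ => Φ.nonneg _) fun i => ?_
      refine le_of_eq_of_le (tsum_congr fun x => ?_)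
        (tsum_slice_le (fun _ => Φ.nonneg _) (hdiff i) ⟨s, hs⟩)
      rw [← Φ.neg, ← hpv]
      congr 1
      rw [map_sub]
      change -(c * (-(p i (s⁻¹ • x) - p i x) -
        ((f.1 (s⁻¹ • x) - f.1 x) - (h (s⁻¹ • x) - h x)))) = _
      rw [edgeGradient_apply, edgeGradient_apply, edgeGradient_apply]
      ring
    exact mem_closure_of_tendsto hconv (Eventually.of_forall fun i =>
      (coboundariesOne (orliczRep G Φ X)).neg_mem
        (dirichletCocycle_mem_coboundariesOne (hp i)))

/-- The flux `Φ'(∇h)` of a harmonic function annihilates the closure of `B¹`. -/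
lemma tsum_deriv_mul_eq_zero_of_mem_closure (hS : Subgroup.closure (S : Set G) = ⊤)
    (hsymm : ∀ s ∈ S, s⁻¹ ∈ S) (hD : Φ.DeltaTwo) (hC : ContDiff ℝ 1 Φ)
    {h f : dirichletSpace G Φ X} (hh : h ∈ harmonicFunctions Φ S X)
    (hf : dirichletCocycle Φ f ∈ (coboundariesOne (orliczRep G Φ X)).topologicalClosure) :
    ∑' e, deriv Φ (edgeGradient S h.1 e) * edgeGradient S f.1 e = 0 := by
  have hhs := (hD.mem_dirichletSpace_iff hS).1 h.2
  have hsl := (summable_prod_iff_of_nonneg fun _ => Φ.nonneg _).1 hhs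
  let L : cocyclesOne (orliczRep G Φ X) → ℝ := fun b =>
    ∑ s : S, OrliczSpace.derivPairing hD hC (fun x => edgeGradient S h.1 (s, x)) (hsl s) (b.1 s)
  have hL : Continuous L := by
    refine continuous_finsetSum _ fun s _ => (ContinuousLinearMap.continuous _).comp ?_
    exact (continuous_eval_const (s : G)).comp continuous_subtype_val
  have hLf : ∀ f : dirichletSpace G Φ X, L (dirichletCocycle Φ f) =
      ∑' e, deriv Φ (edgeGradient S h.1 e) * edgeGradient S f.1 e := by
    intro f
    rw [(hD.summable_deriv_mul hC hhs ((hD.mem_dirichletSpace_iff hS).1 f.2)).tsum_prod,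
      tsum_fintype]
    rfl
  have hzero : ∀ b ∈ coboundariesOne (orliczRep G Φ X), L b = 0 := by
    rintro b ⟨v, hv⟩
    have hvs := OrliczSpace.summable_val hD v
    have hvD : OrliczSpace.val Φ v ∈ dirichletSpace G Φ X :=
      (hD.mem_dirichletSpace_iff hS).2 (hD.summable_gradient hvs)
    have hb : b = dirichletCocycle Φ ⟨OrliczSpace.val Φ v, hvD⟩ :=
      Subtype.ext (ContinuousMap.ext hv)
    rw [hb, hLf, hD.tsum_deriv_gradient_mul hC hsymm hhs hvs]
    simp [hh _]
  rw [← hLf]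
  exact closure_minimal (fun b hb => hzero b hb) (isClosed_singleton.preimage hL) hf

/-- Uniqueness: cohomologous harmonic functions differ by an invariant function. -/
lemma sub_mem_dirichletInvariants (hS : Subgroup.closure (S : Set G) = ⊤)
    (hsymm : ∀ s ∈ S, s⁻¹ ∈ S) (hD : Φ.DeltaTwo) (hC : ContDiff ℝ 1 Φ)
    (hconv : StrictConvexOn ℝ Set.univ Φ) {h k : dirichletSpace G Φ X}
    (hh : h ∈ harmonicFunctions Φ S X) (hk : k ∈ harmonicFunctions Φ S X)
    (hhk : dirichletCocycle Φ h - dirichletCocycle Φ k ∈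
      (coboundariesOne (orliczRep G Φ X)).topologicalClosure) :
    h - k ∈ dirichletInvariants G Φ X := by
  rw [← map_sub] at hhk
  have hhs := (hD.mem_dirichletSpace_iff hS).1 h.2
  have hks := (hD.mem_dirichletSpace_iff hS).1 k.2
  have hds := (hD.mem_dirichletSpace_iff hS).1 (h - k).2
  have h1 := hD.summable_deriv_mul hC hhs hds
  have h2 := hD.summable_deriv_mul hC hks hds
  have h0 := h1.tsum_sub h2
  rw [tsum_deriv_mul_eq_zero_of_mem_closure hS hsymm hD hC hh hhk,
    tsum_deriv_mul_eq_zero_of_mem_closure hS hsymm hD hC hk hhk, sub_zero] at h0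
  have hpt : ∀ e, deriv Φ (edgeGradient S h.1 e) * edgeGradient S (h - k).1 e -
      deriv Φ (edgeGradient S k.1 e) * edgeGradient S (h - k).1 e =
      (deriv Φ (edgeGradient S h.1 e) - deriv Φ (edgeGradient S k.1 e)) *
        (edgeGradient S h.1 e - edgeGradient S k.1 e) := by
    intro e
    rw [Submodule.coe_sub, map_sub, Pi.sub_apply]
    ring
  have hs := h1.sub h2
  simp only [hpt] at h0 hs
  have hz := (hasSum_zero_iff_of_nonneg
    fun e => NFunction.deriv_sub_mul_nonneg hC _ _).1 (h0 ▸ hs.hasSum)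
  have hgrad : edgeGradient S h.1 = edgeGradient S k.1 := funext fun e =>
    NFunction.eq_of_deriv_sub_mul_nonpos hC hconv (congrFun hz e).le
  exact fun g x => sub_smul_eq_of_edgeGradient_eq hS hgrad g x

end Main

theorem corollary3p7 {G X : Type*} [Group G] [TopologicalSpace G] [DiscreteTopology G]
    [MulAction G X] [Countable X]
    (Φ : NFunction) (hC1 : ContDiff ℝ 1 Φ) (hconv : StrictConvexOn ℝ Set.univ Φ)
    (hDelta : Φ.DeltaTwo) (hNabla : Φ.NablaTwo)
    (S : Finset G) (hS : Subgroup.closure (S : Set G) = ⊤) (hsymm : ∀ s ∈ S, s⁻¹ ∈ S)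
    (hfree : ∀ (g : G) (x : X), g • x = x → g = 1) :
    ∃ e : HarmonicQuotient Φ S X ≃ ReducedCohomologyOne (orliczRep G Φ X),
      ∀ h : harmonicFunctions Φ S X,
        e (Quotient.mk (harmonicSetoid Φ S X) h) =
          Submodule.Quotient.mk (dirichletCocycle Φ h.1) := by
  let F : HarmonicQuotient Φ S X → ReducedCohomologyOne (orliczRep G Φ X) :=
    Quotient.lift (fun h => Submodule.Quotient.mk (dirichletCocycle Φ h.1)) fun h k hhk => by
      have hinv := (harmonicSetoid_iff Φ S h k).1 hhk
      have heq : dirichletCocycle Φ (k.1 - h.1) = 0 := by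
        refine Subtype.ext (ContinuousMap.ext fun g => Subtype.ext (funext fun x => ?_))
        exact sub_eq_zero.2 (hinv g⁻¹ x)
      rw [map_sub, sub_eq_zero] at heq
      exact congrArg _ heq.symm
  have hF : Function.Bijective F := by
    constructor
    · rintro ⟨h⟩ ⟨k⟩ hhk
      refine Quotient.sound ((harmonicSetoid_iff Φ S h k).2 ?_)
      exact sub_mem_dirichletInvariants hS hsymm hDelta hC1 hconv k.2 h.2
        ((Submodule.Quotient.eq _).1 hhk.symm)
    · intro y
      obtain ⟨b, rfl⟩ := Submodule.Quotient.mk_surjective _ y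
      obtain ⟨f, rfl⟩ := dirichletCocycle_surjective hfree b
      obtain ⟨h, hh, hfh⟩ := exists_harmonic hfree hS hsymm hDelta hNabla hC1 f
      exact ⟨Quotient.mk _ ⟨h, hh⟩, ((Submodule.Quotient.eq _).2 hfh).symm⟩
  exact ⟨Equiv.ofBijective F hF, fun _ => rfl⟩
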